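/- **Setting.** Let $f:\mathbb R^d\times\mathbb R^d\to\mathbb R^d$ be Lipschitz continuous and let $(x,v)$ solve $\dot x=v$, $\dot v=f(x,v)$ on $[t_0,T]$, $t_0<T$. Let $0\le e_1<\dots<e_M\le 1$ be nodes with Lagrange polynomials $l_j$, put $q_{m,j}=\int_0^{e_m}l_j$, $q_j=\int_0^1 l_j$, and let $p\ge 1$ be the order of the quadrature rule $(q_j,e_j)$ on $[0,1]$, i.e. it integrates polynomials of degree $<p$ exactly (e.g. $p=2M$ for Gauss–Legendre nodes). Let $Q\in\mathbb R^{(M+1)\times(M+1)}$ have zero first row and column and entries $q_{m,j}$ otherwise, let $q=(0,q_1,\dots,q_M)$, and, with $e_0=0$ and $\delta_l=e_l-e_{l-1}$, let (indices $0,\dots,M$) $(Q_E)_{m,l}=\delta_{l+1}$ for $l<m$, $(Q_I)_{m,l}=\delta_l$ for $1\le l\le m$, all other entries zero, $Q_T=\tfrac12(Q_E+Q_I)$, $Q_x=Q_EQ_T+\tfrac12 Q_E\circ Q_E$ ($\circ$ the entrywise product). Matrices act on vectors of node values $X=(X_0,\dots,X_M)\in(\mathbb R^d)^{M+1}$ as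 $A\otimes I_d$; $F(X,V)=(f(X_m,V_m))_{m}$; a single vector of $\mathbb R^d$ in place of such a vector is repeated $M+1$ times. For a step size $h>0$ and values $(x_n,v_n)$ at the beginning of a time step, the collocation solution $(X,V)$ satisfies $X=x_n+hQv_n+h^2QQF(X,V)$, $V=v_n+hQF(X,V)$. Second-order SDC with $k$ iterations starts from node values $(X^0,V^0)$, produced by some starting procedure (which may depend on $h$, $n$, $x_n$, $v_n$), and determines $(X^{i+1},V^{i+1})$, $0\le i<k$, by $$X^{i+1}-h^2Q_xF(X^{i+1},V^{i+1})=x_n+hQv_n+h^2(QQ-Q_x)F(X^i,V^i),$$ $$V^{i+1}-hQ_TF(X^{i+1},V^{i+1})=v_n+h(Q-Q_T)F(X^i,V^i),$$ and then sets $x_{n+1}=x_n+h\,q\,v_n+h^2\,qQ\,F(X^k,V^k)$, $v_{n+1}=v_n+h\,q\,F(X^k,V^k)$. The starting procedure has order $k_0\ge0$ if for every bounded set of values $(x_n,v_n)$ there is a constant $C_0$ such that $\|X-X^0\|\le C_0h^{k_0}$ and $\|V-V^0\|\le C_0h^{k_0}$ for all sufficiently small $h$, where $(X,V)$ is the collocation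 solution. **Theorem.** Assume that $t\mapsto f(x(t),v(t))$ is $p$ times continuously differentiable on $[t_0,T]$ and, if $p>M+1$, that moreover $f$ is $p$ times continuously differentiable in a neighbourhood of the curve $\{(x(t),v(t)):t\in[t_0,T]\}$. Let the starting procedure have order $k_0$, with $k+k_0\ge1$. Then SDC with $k$ iterations per step, started at $(x_0,v_0)=(x(t_0),v(t_0))$, converges globally with order $p^*=\min\{p,k+k_0\}$: there are $C$ and $h_0>0$ such that for all $0<h\le h_0$ the numerical solution $(x_n,v_n)_{n\ge0}$ exists, is unique, and satisfies $$|x(t_0+nh)-x_n|\le C h^{p^*},\qquad |v(t_0+nh)-v_n|\le C h^{p^*}\qquad\text{for all } n \text{ with } t_0+nh\le T.$$ If $f$ does not depend on $v$, the same holds with $p^*=\min\{p,2k+k_0\}$. -/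

import Mathlib

namespace SDC

/-- Positions and velocities live in `ℝ^d` with the Euclidean norm. -/
abbrev Vec (d : ℕ) := EuclideanSpace ℝ (Fin d)

noncomputable section

/-- `∫_0^b l_j(s) ds`, where `l_j` is the Lagrange polynomial of the nodes `e_1, …, e_M`. -/
def weight {M : ℕ} (e : Fin M → ℝ) (b : ℝ) (j : Fin M) : ℝ :=
  ∫ s in (0 : ℝ)..b, (Lagrange.basis Finset.univ e j).eval s

/-- The row vector `q = (0, q_1, …, q_M)` with `q_j = ∫_0^1 l_j`. -/
def q {M : ℕ} (e : Fin M → ℝ) : Fin (M + 1) → ℝ :=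
  Fin.cons 0 (weight e 1)

/-- The interpolatory quadrature rule on `[0,1]` with nodes `e` has order (at least) `p`: it
integrates all polynomials of degree `< p` exactly. -/
def QuadratureOrder {M : ℕ} (e : Fin M → ℝ) (p : ℕ) : Prop :=
  ∀ P : Polynomial ℝ, P.degree < (p : WithBot ℕ) →
    ∑ j, weight e 1 j * P.eval (e j) = ∫ s in (0 : ℝ)..1, P.eval s

/-- The collocation matrix `Q`: first row and column are zero, the remaining entries are
`q_{m,j} = ∫_0^{e_m} l_j`. -/
def Q {M : ℕ} (e : Fin M → ℝ) : Matrix (Fin (M + 1)) (Fin (M + 1)) ℝ :=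
  Matrix.of (Fin.cons 0 fun m => Fin.cons 0 fun j => weight e (e m) j)

/-- Normalized distances `Δτ_{m+1} / Δt` between consecutive nodes, where `τ_0 = t_n`. -/
def gap {M : ℕ} (e : Fin M → ℝ) (m : Fin M) : ℝ :=
  (Fin.cons 0 e : Fin (M + 1) → ℝ) m.succ - (Fin.cons 0 e : Fin (M + 1) → ℝ) m.castSucc

/-- Explicit Euler matrix: row `m` is `(Δτ_1, …, Δτ_m, 0, …, 0) / Δt`. -/
def QE {M : ℕ} (e : Fin M → ℝ) : Matrix (Fin (M + 1)) (Fin (M + 1)) ℝ :=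
  Matrix.of fun m l => if l < m then (Fin.snoc (gap e) 0 : Fin (M + 1) → ℝ) l else 0

/-- Implicit Euler matrix: row `m` is `(0, Δτ_1, …, Δτ_m, 0, …, 0) / Δt`. -/
def QI {M : ℕ} (e : Fin M → ℝ) : Matrix (Fin (M + 1)) (Fin (M + 1)) ℝ :=
  Matrix.of fun m l => if l ≤ m then (Fin.cons 0 (gap e) : Fin (M + 1) → ℝ) l else 0

/-- Trapezoidal matrix `Q_T`. -/
def QT {M : ℕ} (e : Fin M → ℝ) : Matrix (Fin (M + 1)) (Fin (M + 1)) ℝ :=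
  (1 / 2 : ℝ) • (QE e + QI e)

/-- The matrix `Q_x` of the velocity-Verlet position update. -/
def Qx {M : ℕ} (e : Fin M → ℝ) : Matrix (Fin (M + 1)) (Fin (M + 1)) ℝ :=
  QE e * QT e + (1 / 2 : ℝ) • Matrix.hadamard (QE e) (QE e)

/-- The action of `A ⊗ I_d` on a vector of node values. -/
def act {n d : ℕ} (A : Matrix (Fin n) (Fin n) ℝ) (W : Fin n → Vec d) : Fin n → Vec d :=
  fun m => ∑ l, A m l • W l

/-- The vector `F(X, V)` of the forces at all nodes. -/
def force {n d : ℕ} (f : Vec d × Vec d → Vec d) (X V : Fin n → Vec d) : Fin n → Vec d :=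
  fun m => f (X m, V m)

/-- `(X, V)` solves the collocation problem with step size `h` and initial values `x₀, v₀`. -/
def IsCollocationSolution {M d : ℕ} (e : Fin M → ℝ) (f : Vec d × Vec d → Vec d) (h : ℝ)
    (x₀ v₀ : Vec d) (X V : Fin (M + 1) → Vec d) : Prop :=
  X = (fun _ => x₀) + h • act (Q e) (fun _ => v₀) + h ^ 2 • act (Q e * Q e) (force f X V) ∧
  V = (fun _ => v₀) + h • act (Q e) (force f X V)

/-- One SDC iteration, from the node values `(X, V)` to the node values `(X', V')`. -/
def IsSweep {M d : ℕ} (e : Fin M → ℝ) (f : Vec d × Vec d → Vec d) (h : ℝ)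
    (x₀ v₀ : Vec d) (X V X' V' : Fin (M + 1) → Vec d) : Prop :=
  X' - h ^ 2 • act (Qx e) (force f X' V') =
    (fun _ => x₀) + h • act (Q e) (fun _ => v₀) + h ^ 2 • act (Q e * Q e - Qx e) (force f X V) ∧
  V' - h • act (QT e) (force f X' V') =
    (fun _ => v₀) + h • act (Q e - QT e) (force f X V)

/-- One time step of SDC with `k` iterations started from the node values `(X₀, V₀)`: it takes
`(x₀, v₀)` at the beginning of the time step to `(x₁, v₁)` at its end. -/
def IsStep {M d : ℕ} (e : Fin M → ℝ) (f : Vec d × Vec d → Vec d) (k : ℕ) (h : ℝ)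
    (X₀ V₀ : Fin (M + 1) → Vec d) (x₀ v₀ x₁ v₁ : Vec d) : Prop :=
  ∃ X V : ℕ → Fin (M + 1) → Vec d,
    X 0 = X₀ ∧ V 0 = V₀ ∧
    (∀ i < k, IsSweep e f h x₀ v₀ (X i) (V i) (X (i + 1)) (V (i + 1))) ∧
    x₁ = x₀ + h • ∑ m, q e m • v₀ + h ^ 2 • ∑ m, (Matrix.vecMul (q e) (Q e)) m • f (X k m, V k m) ∧
    v₁ = v₀ + h • ∑ m, q e m • f (X k m, V k m)

/-- A procedure for generating the starting value `U⁰ = (X⁰, V⁰)` of the iteration: it may depend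
on the step size, on the number of the time step and on the values at the beginning of the
step. -/
abbrev Starter (M d : ℕ) :=
  ℝ → ℕ → Vec d → Vec d → (Fin (M + 1) → Vec d) × (Fin (M + 1) → Vec d)

/-- The starting procedure has order `k₀`: `‖X - X⁰‖ ≤ C₀ Δt^k₀` and `‖V - V⁰‖ ≤ C₀ Δt^k₀` for the
collocation solution `(X, V)`, for all small `Δt`, where `C₀` does not depend on `Δt` and is locally
uniform in the values at the beginning of the time step. -/
def StarterOrder {M d : ℕ} (e : Fin M → ℝ) (f : Vec d × Vec d → Vec d) (S : Starter M d)
    (k₀ : ℕ) : Prop :=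
  ∀ R : ℝ, ∃ C₀ h₀ : ℝ, 0 < h₀ ∧ ∀ h, 0 < h → h ≤ h₀ → ∀ (n : ℕ) (x₀ v₀ : Vec d),
    ‖x₀‖ ≤ R → ‖v₀‖ ≤ R → ∀ X V, IsCollocationSolution e f h x₀ v₀ X V →
      ∀ m, ‖X m - (S h n x₀ v₀).1 m‖ ≤ C₀ * h ^ k₀ ∧ ‖V m - (S h n x₀ v₀).2 m‖ ≤ C₀ * h ^ k₀

/-- `u n = (x_n, v_n)` is the numerical solution produced by SDC with `k` iterations per time step,
constant step size `h` and initial values `x₀, v₀`. -/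
def IsRun {M d : ℕ} (e : Fin M → ℝ) (f : Vec d × Vec d → Vec d) (k : ℕ) (S : Starter M d)
    (h : ℝ) (x₀ v₀ : Vec d) (u : ℕ → Vec d × Vec d) : Prop :=
  u 0 = (x₀, v₀) ∧ ∀ n, IsStep e f k h (S h n (u n).1 (u n).2).1 (S h n (u n).1 (u n).2).2
    (u n).1 (u n).2 (u (n + 1)).1 (u (n + 1)).2

/-- `(x, v)` solves `x' = v`, `v' = f(x, v)` on `[t₀, T]`. -/
def IsSolution {d : ℕ} (f : Vec d × Vec d → Vec d) (t₀ T : ℝ) (x v : ℝ → Vec d) : Prop :=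
  ∀ t ∈ Set.Icc t₀ T, HasDerivWithinAt x (v t) (Set.Icc t₀ T) t ∧
    HasDerivWithinAt v (f (x t, v t)) (Set.Icc t₀ T) t

/-- SDC with `k` iterations converges globally with order `r` to `(x, v)` on `[t₀, T]`: for all
sufficiently small step sizes the method is well defined and the errors of position and velocity
at all grid points are at most `C * h ^ r`. -/
def ConvergesWithOrder {M d : ℕ} (e : Fin M → ℝ) (f : Vec d × Vec d → Vec d) (k : ℕ)
    (S : Starter M d) (t₀ T : ℝ) (x v : ℝ → Vec d) (r : ℕ) : Prop :=
  ∃ C h₀ : ℝ, 0 < h₀ ∧ ∀ h, 0 < h → h ≤ h₀ →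
    (∃! u, IsRun e f k S h (x t₀) (v t₀) u) ∧
    ∀ u, IsRun e f k S h (x t₀) (v t₀) u → ∀ n : ℕ, t₀ + n * h ≤ T →
      ‖x (t₀ + n * h) - (u n).1‖ ≤ C * h ^ r ∧ ‖v (t₀ + n * h) - (u n).2‖ ≤ C * h ^ r

end

end SDC

/-! The proof compares a step of SDC with the collocation step from the same values. Both are fixed
point problems for the forces `F(X, V)`, and the collocation solution is a fixed point of the sweep;
hence each sweep multiplies the distance of the forces to those of collocation by `O(h)`, and by
`O(h ^ 2)` if `f` does not depend on the velocity, because the velocities enter the positions only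
through the forces. After `k` sweeps the step therefore differs from the collocation step by
`O(h ^ (s + 1))` with `s = k + k₀` or `s = 2 k + k₀`.

Second-order collocation is ordinary collocation for the first-order system of `(x, v)`. If
`p ≤ M + 1`, its local error `O(h ^ (p + 1))` follows from interpolation at the nodes. If
`p > M + 1`, the error satisfies the linearized equation at the nodes up to `O(h ^ (2 M + 2))`, and
`p ≤ 2 M`; integrating the defect of this equation against an approximate resolvent which is itself
a polynomial in `h s` up to higher order, the quadrature rule sees only the small values of the
defect at the nodes, which gives superconvergence. Lipschitz continuity of the collocation step and
a discrete Gronwall argument yield the global error. -/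

namespace SDC

open Set Filter Asymptotics MeasureTheory Topology

/-! ### Uniform expansions in the step size -/

section UniformBigO

variable {ι E F G : Type*} [NormedAddCommGroup E] [NormedAddCommGroup F] [NormedAddCommGroup G]
  {h : ι → ℝ} {r r' : ℕ}

/-- The family `φ` of functions on `[0, 1]` is `O(h ^ r)`, uniformly in the variable and in the
index. The index `i` stands for everything a time step depends on, `h i` for its step size. -/
def UniformBigO (h : ι → ℝ) (r : ℕ) (φ : ι → ℝ → E) : Prop :=
  (fun x : ι × ℝ => φ x.1 x.2) =O[𝓟 (univ ×ˢ Icc 0 1)] fun x => h x.1 ^ r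

theorem UniformBigO.of_bound {φ : ι → ℝ → E} (C : ℝ)
    (hφ : ∀ i, ∀ s ∈ Icc (0 : ℝ) 1, ‖φ i s‖ ≤ C * h i ^ r) : UniformBigO h r φ := by
  refine isBigO_principal.2 ⟨|C|, fun x hx => (hφ x.1 x.2 hx.2).trans ?_⟩
  rw [Real.norm_eq_abs, ← abs_mul]
  exact le_abs_self _

theorem UniformBigO.exists_bound {φ : ι → ℝ → E} (hh : ∀ i, h i ∈ Ioc (0 : ℝ) 1)
    (hφ : UniformBigO h r φ) :
    ∃ C : ℝ, 0 ≤ C ∧ ∀ i, ∀ s ∈ Icc (0 : ℝ) 1, ‖φ i s‖ ≤ C * h i ^ r := by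
  obtain ⟨C, hC0, hC⟩ := hφ.exists_nonneg
  refine ⟨C, hC0, fun i s hs => (isBigOWith_principal.1 hC (i, s) ⟨mem_univ i, hs⟩).trans_eq ?_⟩
  rw [Real.norm_of_nonneg (pow_nonneg (hh i).1.le r)]

theorem UniformBigO.congr {φ ψ : ι → ℝ → E} (hφ : UniformBigO h r φ)
    (heq : ∀ i, EqOn (ψ i) (φ i) (Icc 0 1)) : UniformBigO h r ψ :=
  IsBigO.congr' hφ (eventually_principal.2 fun x hx => (heq x.1 hx.2).symm) EventuallyEq.rfl

theorem UniformBigO.of_norm_le {φ : ι → ℝ → E} {ψ : ι → ℝ → F} (hφ : UniformBigO h r φ) (C : ℝ)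
    (hle : ∀ i, ∀ s ∈ Icc (0 : ℝ) 1, ‖ψ i s‖ ≤ C * ‖φ i s‖) : UniformBigO h r ψ :=
  IsBigO.trans (isBigO_principal.2 ⟨C, fun x hx => hle x.1 x.2 hx.2⟩) hφ

theorem UniformBigO.add {φ ψ : ι → ℝ → E} (hφ : UniformBigO h r φ) (hψ : UniformBigO h r ψ) :
    UniformBigO h r (φ + ψ) :=
  IsBigO.add hφ hψ

theorem UniformBigO.sub {φ ψ : ι → ℝ → E} (hφ : UniformBigO h r φ) (hψ : UniformBigO h r ψ) :
    UniformBigO h r (φ - ψ) :=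
  IsBigO.sub hφ hψ

theorem UniformBigO.sum {κ : Type*} (s : Finset κ) {φ : κ → ι → ℝ → E}
    (hφ : ∀ j ∈ s, UniformBigO h r (φ j)) : UniformBigO h r fun i t => ∑ j ∈ s, φ j i t :=
  IsBigO.fun_sum hφ

theorem UniformBigO.of_le {φ : ι → ℝ → E} (hh : ∀ i, h i ∈ Ioc (0 : ℝ) 1)
    (hφ : UniformBigO h r φ) (hr : r' ≤ r) : UniformBigO h r' φ := by
  refine hφ.trans (isBigO_principal.2 ⟨1, fun x _ => ?_⟩)
  obtain ⟨h0, h1⟩ := hh x.1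
  simpa only [norm_pow, Real.norm_of_nonneg h0.le, one_mul] using pow_le_pow_of_le_one h0.le h1 hr

theorem UniformBigO.eval {φ : ι → ℝ → E} (hφ : UniformBigO h r φ) {t : ℝ}
    (ht : t ∈ Icc (0 : ℝ) 1) : UniformBigO h r fun i _ => φ i t :=
  IsBigO.comp_tendsto (k := fun x : ι × ℝ => (x.1, t)) hφ
    (tendsto_principal_principal.2 fun x _ => ⟨mem_univ x.1, ht⟩)

variable [NormedSpace ℝ E] [NormedSpace ℝ F] [NormedSpace ℝ G]

theorem UniformBigO.bilin (L : E →L[ℝ] F →L[ℝ] G) {φ : ι → ℝ → E} {ψ : ι → ℝ → F}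
    (hφ : UniformBigO h r φ) (hψ : UniformBigO h r' ψ) :
    UniformBigO h (r + r') fun i s => L (φ i s) (ψ i s) := by
  have hL : (fun x : ι × ℝ => L (φ x.1 x.2) (ψ x.1 x.2)) =O[𝓟 (univ ×ˢ Icc 0 1)]
      fun x => ‖φ x.1 x.2‖ * ‖ψ x.1 x.2‖ :=
    .of_bound ‖L‖ (.of_forall fun x => by
      simpa [mul_assoc] using L.le_opNorm₂ (φ x.1 x.2) (ψ x.1 x.2))
  exact hL.trans (by simpa only [pow_add] using (hφ.norm_left.mul hψ.norm_left))

theorem UniformBigO.const_smul {φ : ι → ℝ → E} (hφ : UniformBigO h r φ) (c : ℝ) :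
    UniformBigO h r fun i s => c • φ i s :=
  hφ.const_smul_left c

theorem UniformBigO.step_pow_smul (k : ℕ) {φ : ι → ℝ → E} (hφ : UniformBigO h r φ) :
    UniformBigO h (k + r) fun i s => h i ^ k • φ i s := by
  simpa only [UniformBigO, pow_add, smul_eq_mul] using
    (isBigO_refl (fun x : ι × ℝ => h x.1 ^ k) (𝓟 (univ ×ˢ Icc 0 1))).smul hφ

theorem UniformBigO.integral (hh : ∀ i, h i ∈ Ioc (0 : ℝ) 1) {c : ℝ} (hc : c ∈ Icc (0 : ℝ) 1)
    {φ : ι → ℝ → E} (hφ : UniformBigO h r φ) :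
    UniformBigO h r fun i s => ∫ σ in c..s, φ i σ := by
  obtain ⟨C, hC0, hC⟩ := hφ.exists_bound hh
  refine .of_bound C fun i s hs => ?_
  have hint : ‖∫ σ in c..s, φ i σ‖ ≤ C * h i ^ r * |s - c| :=
    intervalIntegral.norm_integral_le_of_norm_le_const fun σ hσ =>
      hC i σ (uIcc_subset_Icc hc hs (uIoc_subset_uIcc hσ))
  refine hint.trans (mul_le_of_le_one_right (mul_nonneg hC0 (pow_nonneg (hh i).1.le r)) ?_)
  rw [abs_le]
  constructor <;> linarith [hc.1, hc.2, hs.1, hs.2]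

end UniformBigO

section Jets

variable {ι E F G : Type*} [NormedAddCommGroup E] [NormedSpace ℝ E]
  [NormedAddCommGroup F] [NormedSpace ℝ F] [NormedAddCommGroup G] [NormedSpace ℝ G]
  {h : ι → ℝ} {r r' : ℕ}

/-- Families of functions on `[0, 1]` which are polynomials in `h s` with bounded coefficients, up
to a continuous remainder `O(h ^ r)`. Only the powers of the product `h s` are allowed: this is what
makes a quadrature rule of order `p` integrate a jet up to `O(h ^ p)`. -/
inductive IsJet (h : ι → ℝ) (r : ℕ) : (ι → ℝ → E) → Prop
  | monomial (k : ℕ) (a : ι → E) (ha : UniformBigO h 0 fun i _ => a i) :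
      IsJet h r fun i s => (h i * s) ^ k • a i
  | remainder (φ : ι → ℝ → E) (hc : ∀ i, ContinuousOn (φ i) (Icc 0 1)) (hb : UniformBigO h r φ) :
      IsJet h r φ
  | add (φ ψ : ι → ℝ → E) (hφ : IsJet h r φ) (hψ : IsJet h r ψ) : IsJet h r (φ + ψ)
  | congr (φ ψ : ι → ℝ → E) (hφ : IsJet h r φ) (heq : ∀ i, EqOn (ψ i) (φ i) (Icc 0 1)) :
      IsJet h r ψ

theorem IsJet.continuousOn {φ : ι → ℝ → E} (hφ : IsJet h r φ) (i : ι) :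
    ContinuousOn (φ i) (Icc 0 1) := by
  induction hφ with
  | monomial k a _ => exact Continuous.continuousOn (by fun_prop)
  | remainder _ hc _ => exact hc i
  | add φ ψ _ _ h1 h2 => exact h1.add h2
  | congr φ ψ _ heq h1 => exact h1.congr (heq i)

theorem IsJet.intervalIntegrable {φ : ι → ℝ → E} (hφ : IsJet h r φ) (i : ι) {a b : ℝ}
    (ha : a ∈ Icc (0 : ℝ) 1) (hb : b ∈ Icc (0 : ℝ) 1) : IntervalIntegrable (φ i) volume a b :=
  ((hφ.continuousOn i).mono (uIcc_subset_Icc ha hb)).intervalIntegrable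

theorem uniformBigO_monomial (k : ℕ) {a : ι → E} (ha : UniformBigO h 0 fun i _ => a i) :
    UniformBigO h k fun i s => (h i * s) ^ k • a i := by
  have hs : UniformBigO h 0 fun _ s => s ^ k := .of_bound 1 fun i s hs => by
    simpa [abs_of_nonneg hs.1] using pow_le_one₀ hs.1 hs.2
  refine ((hs.bilin (ContinuousLinearMap.lsmul ℝ ℝ) ha).step_pow_smul k).congr fun i s _ => ?_
  simp only [mul_pow, mul_smul, ContinuousLinearMap.lsmul_apply]

theorem IsJet.uniformBigO (hh : ∀ i, h i ∈ Ioc (0 : ℝ) 1) {φ : ι → ℝ → E} (hφ : IsJet h r φ) :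
    UniformBigO h 0 φ := by
  induction hφ with
  | monomial k a ha => exact (uniformBigO_monomial k ha).of_le hh k.zero_le
  | remainder _ _ hb => exact hb.of_le hh r.zero_le
  | add φ ψ _ _ h1 h2 => exact h1.add h2
  | congr φ ψ _ heq h1 => exact h1.congr heq

theorem IsJet.of_le (hh : ∀ i, h i ∈ Ioc (0 : ℝ) 1) {φ : ι → ℝ → E} (hφ : IsJet h r φ)
    (hr : r' ≤ r) : IsJet h r' φ := by
  induction hφ with
  | monomial k a ha => exact .monomial k a ha
  | remainder φ hc hb => exact .remainder φ hc (hb.of_le hh hr)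
  | add φ ψ _ _ h1 h2 => exact .add _ _ h1 h2
  | congr φ ψ _ heq h1 => exact .congr _ _ h1 heq

theorem IsJet.const {a : ι → E} (ha : UniformBigO h 0 fun i _ => a i) :
    IsJet h r fun i _ => a i :=
  .congr _ _ (.monomial 0 a ha) fun i s _ => by rw [pow_zero, one_smul]

theorem continuousOn_bilin (L : E →L[ℝ] F →L[ℝ] G) {φ : ℝ → E} {ψ : ℝ → F}
    {s : Set ℝ} (hφ : ContinuousOn φ s) (hψ : ContinuousOn ψ s) :
    ContinuousOn (fun t => L (φ t) (ψ t)) s :=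
  (L.continuous.comp_continuousOn hφ).clm_apply hψ

theorem IsJet.bilin (hh : ∀ i, h i ∈ Ioc (0 : ℝ) 1) (L : E →L[ℝ] F →L[ℝ] G)
    {φ : ι → ℝ → E} {ψ : ι → ℝ → F} (hφ : IsJet h r φ) (hψ : IsJet h r ψ) :
    IsJet h r fun i s => L (φ i s) (ψ i s) := by
  induction hφ with
  | monomial k a ha =>
    induction hψ with
    | monomial l b hb =>
      refine .congr _ _ (.monomial (k + l) (fun i => L (a i) (b i)) (ha.bilin L hb)) ?_
      intro i s _
      simp only [map_smul, smul_apply, smul_smul, pow_add, mul_comm]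
    | remainder ψ hc hb =>
      have hk : UniformBigO h 0 fun i s => (h i * s) ^ k • a i :=
        (uniformBigO_monomial k ha).of_le hh k.zero_le
      refine .remainder _
        (fun i => continuousOn_bilin L (Continuous.continuousOn (by fun_prop)) (hc i)) ?_
      simpa only [zero_add] using hk.bilin L hb
    | add ψ χ _ _ h1 h2 => exact .congr _ _ (.add _ _ h1 h2) fun i s _ => map_add _ _ _
    | congr ψ χ _ heq h1 => exact .congr _ _ h1 fun i s hs => congrArg _ (heq i hs)
  | remainder φ hc hb =>
    exact .remainder _ (fun i => continuousOn_bilin L (hc i) (hψ.continuousOn i))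
      (hb.bilin L (hψ.uniformBigO hh))
  | add φ χ _ _ h1 h2 =>
    exact .congr _ _ (.add _ _ h1 h2) fun i s _ => L.map_add₂ (φ i s) (χ i s) (ψ i s)
  | congr φ χ _ heq h1 => exact .congr _ _ h1 fun i s hs => by simp only [heq i hs]

theorem IsJet.sub {φ ψ : ι → ℝ → E} (hφ : IsJet h r φ) (hψ : IsJet h r ψ) :
    IsJet h r (φ - ψ) := by
  have hneg : IsJet h r (-ψ) := by
    induction hψ with
    | monomial k a ha =>
      exact .congr _ _ (.monomial k (-a) ha.neg_left) fun i s _ => (smul_neg _ _).symm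
    | remainder ψ hc hb => exact .remainder _ (fun i => (hc i).neg) hb.neg_left
    | add φ ψ _ _ h1 h2 => exact .congr _ _ (.add _ _ h1 h2) fun i s _ => neg_add _ _
    | congr φ ψ _ heq h1 => exact .congr _ _ h1 fun i s hs => congrArg _ (heq i hs)
  simpa only [sub_eq_add_neg] using IsJet.add _ _ hφ hneg

theorem IsJet.sum {κ : Type*} (s : Finset κ) {φ : κ → ι → ℝ → E}
    (hφ : ∀ j ∈ s, IsJet h r (φ j)) : IsJet h r fun i t => ∑ j ∈ s, φ j i t := by
  simp only [← Finset.sum_apply]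
  exact Finset.sum_induction φ (IsJet h r) IsJet.add
    (.remainder _ (fun _ => continuousOn_const) (isBigO_zero _ _)) hφ

theorem IsJet.bilin_of_uniformBigO_one (hh : ∀ i, h i ∈ Ioc (0 : ℝ) 1) (L : E →L[ℝ] F →L[ℝ] G)
    {φ : ι → ℝ → E} {ψ : ι → ℝ → F} (hφ : IsJet h r φ) (hψ : IsJet h (r + 1) ψ)
    (hψ1 : UniformBigO h 1 ψ) : IsJet h (r + 1) fun i s => L (φ i s) (ψ i s) := by
  induction hφ with
  | monomial k a ha => exact IsJet.bilin hh L (.monomial k a ha) hψ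
  | remainder φ hc hb =>
    exact .remainder _ (fun i => continuousOn_bilin L (hc i) (hψ.continuousOn i))
      (hb.bilin L hψ1)
  | add φ χ _ _ h1 h2 =>
    exact .congr _ _ (.add _ _ h1 h2) fun i s _ => L.map_add₂ (φ i s) (χ i s) (ψ i s)
  | congr φ χ _ heq h1 => exact .congr _ _ h1 fun i s hs => by simp only [heq i hs]

theorem continuousOn_integral {φ : ℝ → E} (hφ : ContinuousOn φ (Icc 0 1)) {c : ℝ}
    (hc : c ∈ Icc (0 : ℝ) 1) : ContinuousOn (fun s => ∫ σ in c..s, φ σ) (Icc 0 1) := by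
  rw [← uIcc_of_le (zero_le_one (α := ℝ))] at hφ hc ⊢
  exact intervalIntegral.continuousOn_primitive_interval' hφ.intervalIntegrable hc

theorem IsJet.step_integral [CompleteSpace E] (hh : ∀ i, h i ∈ Ioc (0 : ℝ) 1)
    {φ : ι → ℝ → E} (hφ : IsJet h r φ) :
    IsJet h (r + 1) fun i s => h i • ∫ σ in (0 : ℝ)..s, φ i σ := by
  induction hφ with
  | monomial k a ha =>
    refine .congr _ _ (.monomial (k + 1) _ (ha.const_smul ((k : ℝ) + 1)⁻¹)) fun i s _ => ?_
    simp only [mul_pow]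
    rw [intervalIntegral.integral_smul_const, intervalIntegral.integral_const_mul, integral_pow,
      smul_smul, smul_smul, zero_pow k.succ_ne_zero, sub_zero]
    congr 1
    ring
  | remainder φ hc hb =>
    refine .remainder _ (fun i => continuousOn_const.smul (continuousOn_integral (hc i) ?_)) ?_
    · exact ⟨le_rfl, zero_le_one⟩
    · simpa only [pow_one, add_comm 1 r] using
        (hb.integral hh ⟨le_rfl, zero_le_one⟩).step_pow_smul 1
  | add φ ψ hφ hψ h1 h2 =>
    refine .congr _ _ (.add _ _ h1 h2) fun i s hs => ?_
    simp only [Pi.add_apply]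
    rw [intervalIntegral.integral_add (hφ.intervalIntegrable i (by simp) hs)
      (hψ.intervalIntegrable i (by simp) hs), smul_add]
  | congr φ ψ _ heq h1 =>
    refine .congr _ _ h1 fun i s hs => congrArg _ (intervalIntegral.integral_congr ?_)
    exact (heq i).mono (uIcc_subset_Icc ⟨le_rfl, zero_le_one⟩ hs)

theorem IsJet.step_integral_from [CompleteSpace E] (hh : ∀ i, h i ∈ Ioc (0 : ℝ) 1) {c : ℝ}
    (hc : c ∈ Icc (0 : ℝ) 1) {φ : ι → ℝ → E} (hφ : IsJet h r φ) :
    IsJet h (r + 1) fun i s => h i • ∫ σ in c..s, φ i σ := by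
  have hzero := hφ.step_integral hh
  refine (hzero.sub (.const ((hzero.uniformBigO hh).eval hc))).congr _ _ fun i s hs => ?_
  rw [Pi.sub_apply, Pi.sub_apply, ← smul_sub, intervalIntegral.integral_interval_sub_left
    (hφ.intervalIntegrable i ⟨le_rfl, zero_le_one⟩ hs)
    (hφ.intervalIntegrable i ⟨le_rfl, zero_le_one⟩ hc)]

end Jets

/-! ### Interpolation and quadrature -/

section TimeSteps

variable {ι E : Type*} [NormedAddCommGroup E] {h t : ι → ℝ} {a b : ℝ}

/-- A family of time steps of size at most `1` inside `[a, b]`: step `i` leads from `t i` to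
`t i + h i`. -/
structure IsStepFamily (a b : ℝ) (h t : ι → ℝ) : Prop where
  step_mem (i : ι) : h i ∈ Ioc (0 : ℝ) 1
  left_le (i : ι) : a ≤ t i
  right_le (i : ι) : t i + h i ≤ b

theorem IsStepFamily.mapsTo (hst : IsStepFamily a b h t) (i : ι) :
    MapsTo (fun s => t i + h i * s) (Icc 0 1) (Icc a b) := fun s hs => by
  have h0 := (hst.step_mem i).1.le
  have hle : t i + h i * s ≤ t i + h i := by
    gcongr
    exact mul_le_of_le_one_right h0 hs.2
  exact ⟨(hst.left_le i).trans (le_add_of_nonneg_right (mul_nonneg h0 hs.1)),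
    hle.trans (hst.right_le i)⟩

theorem IsStepFamily.uniformBigO_comp (hst : IsStepFamily a b h t) {g : ℝ → E}
    (hg : ContinuousOn g (Icc a b)) : UniformBigO h 0 fun i s => g (t i + h i * s) := by
  obtain ⟨C, hC⟩ := isCompact_Icc.exists_bound_of_continuousOn hg
  exact .of_bound C fun i s hs => by simpa only [pow_zero, mul_one] using hC _ (hst.mapsTo i hs)

theorem IsStepFamily.continuousOn_comp (hst : IsStepFamily a b h t) {g : ℝ → E}
    (hg : ContinuousOn g (Icc a b)) (i : ι) :
    ContinuousOn (fun s => g (t i + h i * s)) (Icc 0 1) :=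
  hg.comp (Continuous.continuousOn (by fun_prop)) (hst.mapsTo i)

variable [NormedSpace ℝ E]

theorem IsStepFamily.step_integral [CompleteSpace E] (hst : IsStepFamily a b h t) {g g' : ℝ → E}
    (hg : ∀ y ∈ Icc a b, HasDerivWithinAt g (g' y) (Icc a b) y)
    (hg' : ContinuousOn g' (Icc a b)) (i : ι) {s : ℝ} (hs : s ∈ Icc (0 : ℝ) 1) :
    h i • ∫ σ in (0 : ℝ)..s, g' (t i + h i * σ) = g (t i + h i * s) - g (t i) := by
  rw [intervalIntegral.smul_integral_comp_add_mul, mul_zero, add_zero]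
  have hle : t i ≤ t i + h i * s :=
    le_add_of_nonneg_right (mul_nonneg (hst.step_mem i).1.le hs.1)
  have hsub : Icc (t i) (t i + h i * s) ⊆ Icc a b :=
    Icc_subset_Icc (hst.left_le i) (hst.mapsTo i hs).2
  refine intervalIntegral.integral_eq_sub_of_hasDerivAt_of_le hle
    (fun y hy => (hg y (hsub hy)).continuousWithinAt.mono hsub) (fun y hy => ?_)
    ((hg'.mono ((uIcc_of_le hle).trans_subset hsub)).intervalIntegrable)
  exact (hg y (hsub (Ioo_subset_Icc_self hy))).hasDerivAt
    (Icc_mem_nhds ((hst.left_le i).trans_lt hy.1) (hy.2.trans_le (hst.mapsTo i hs).2))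

theorem IsStepFamily.isJet_comp [CompleteSpace E] (hst : IsStepFamily a b h t) (hab : a < b)
    (r : ℕ) {g : ℝ → E} (hg : ContDiffOn ℝ r g (Icc a b)) :
    IsJet h r fun i s => g (t i + h i * s) := by
  induction r generalizing g with
  | zero =>
    have hc := hg.continuousOn
    exact .remainder _ (hst.continuousOn_comp hc) (hst.uniformBigO_comp hc)
  | succ r ih =>
    have hg' : ContDiffOn ℝ r (derivWithin g (Icc a b)) (Icc a b) :=
      hg.derivWithin (uniqueDiffOn_Icc hab) (by norm_cast)
    have hderiv : ∀ y ∈ Icc a b, HasDerivWithinAt g (derivWithin g (Icc a b) y) (Icc a b) y :=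
      fun y hy => ((hg.differentiableOn (by simp)) y hy).hasDerivWithinAt
    have hconst : UniformBigO h 0 fun i _ => g (t i) := by
      simpa only [mul_zero, add_zero] using
        (hst.uniformBigO_comp hg.continuousOn).eval (t := 0) ⟨le_rfl, zero_le_one⟩
    refine .congr _ _ (.add _ _ (.const hconst) ((ih hg').step_integral hst.step_mem))
      fun i s hs => ?_
    rw [Pi.add_apply, Pi.add_apply, hst.step_integral hderiv hg'.continuousOn i hs,
      add_sub_cancel]

end TimeSteps

section Interpolation

variable {ι E : Type*} [NormedAddCommGroup E] [NormedSpace ℝ E]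
  {h : ι → ℝ} {r M : ℕ} {e : Fin M → ℝ}

/-- The polynomial of degree less than `M` with values `y j` at the nodes `e j`. -/
noncomputable def interp (e : Fin M → ℝ) (y : Fin M → E) (s : ℝ) : E :=
  ∑ j, (Lagrange.basis Finset.univ e j).eval s • y j

/-- The error of the interpolation of `φ` at the nodes `e`. -/
noncomputable def interpError (e : Fin M → ℝ) (φ : ℝ → E) (s : ℝ) : E :=
  φ s - interp e (φ ∘ e) s

theorem continuous_interp (e : Fin M → ℝ) (y : Fin M → E) : Continuous (interp e y) :=
  continuous_finsetSum _ fun _ _ => (Polynomial.continuous _).smul continuous_const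

theorem interp_add (y z : Fin M → E) (s : ℝ) :
    interp e (y + z) s = interp e y s + interp e z s := by
  simp only [interp, Pi.add_apply, smul_add, Finset.sum_add_distrib]

theorem interpError_add (φ ψ : ℝ → E) (s : ℝ) :
    interpError e (φ + ψ) s = interpError e φ s + interpError e ψ s := by
  simp only [interpError, Pi.add_apply, Pi.add_comp, interp_add]
  abel

theorem interpError_congr (he01 : ∀ j, e j ∈ Icc (0 : ℝ) 1) {φ ψ : ℝ → E}
    (heq : EqOn φ ψ (Icc 0 1)) : EqOn (interpError e φ) (interpError e ψ) (Icc 0 1) := by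
  intro s hs
  rw [interpError, interpError, heq hs, show φ ∘ e = ψ ∘ e from funext fun j => heq (he01 j)]

theorem interp_node (he : Function.Injective e) (y : Fin M → E) (j : Fin M) :
    interp e y (e j) = y j := by
  rw [interp, Finset.sum_eq_single_of_mem j (Finset.mem_univ j) fun k _ hk => by
    rw [Lagrange.eval_basis_of_ne hk (Finset.mem_univ j), zero_smul],
    Lagrange.eval_basis_self he.injOn (Finset.mem_univ j), one_smul]

theorem interp_monomial (he : Function.Injective e) {k : ℕ} (hk : k < M) (c : ℝ) (a : E) (s : ℝ) :
    interp e (fun j => (c * e j) ^ k • a) s = (c * s) ^ k • a := by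
  have hX : s ^ k = ∑ j, e j ^ k * (Lagrange.basis Finset.univ e j).eval s := by
    simpa [Lagrange.interpolate_apply, Polynomial.eval_finsetSum] using
      congrArg (Polynomial.eval s) (Lagrange.eq_interpolate (s := Finset.univ) (v := e)
        (f := (Polynomial.X ^ k : Polynomial ℝ)) he.injOn (by simpa using hk))
  rw [mul_pow, hX, Finset.mul_sum, Finset.sum_smul]
  refine Finset.sum_congr rfl fun j _ => ?_
  rw [smul_smul]
  ring_nf

theorem integral_interp [CompleteSpace E] (y : Fin M → E) (b : ℝ) :
    ∫ s in (0 : ℝ)..b, interp e y s = ∑ j, weight e b j • y j := by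
  simp only [interp, weight, ← intervalIntegral.integral_smul_const]
  exact intervalIntegral.integral_finsetSum fun j _ =>
    ((Polynomial.continuous _).smul continuous_const).intervalIntegrable _ _

theorem integral_interpError [CompleteSpace E] {φ : ℝ → E} (hφ : ContinuousOn φ (Icc 0 1)) {b : ℝ}
    (hb : b ∈ Icc (0 : ℝ) 1) : ∫ s in (0 : ℝ)..b, interpError e φ s =
      (∫ s in (0 : ℝ)..b, φ s) - ∑ j, weight e b j • φ (e j) := by
  simp only [interpError]
  rw [intervalIntegral.integral_sub
    ((hφ.mono (uIcc_subset_Icc ⟨le_rfl, zero_le_one⟩ hb)).intervalIntegrable)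
    ((continuous_interp e _).intervalIntegrable _ _), integral_interp]
  rfl

theorem UniformBigO.sum_weight_smul {y : ι → Fin M → E} (b : ℝ)
    (hy : ∀ j, UniformBigO h r fun i _ => y i j) :
    UniformBigO h r fun i _ => ∑ j, weight e b j • y i j :=
  .sum _ fun j _ => (hy j).const_smul (weight e b j)

theorem UniformBigO.interp {y : ι → Fin M → E} (hy : ∀ j, UniformBigO h r fun i _ => y i j) :
    UniformBigO h r fun i => SDC.interp e (y i) := by
  refine UniformBigO.sum _ fun j _ => ?_
  obtain ⟨C, hC⟩ := isCompact_Icc.exists_bound_of_continuousOn (s := Icc (0 : ℝ) 1)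
    (Lagrange.basis Finset.univ e j).continuous.continuousOn
  have hbasis : UniformBigO h 0 fun _ s => (Lagrange.basis Finset.univ e j).eval s :=
    .of_bound C fun i s hs => by simpa only [pow_zero, mul_one] using hC s hs
  simpa only [zero_add, ContinuousLinearMap.lsmul_apply] using
    hbasis.bilin (ContinuousLinearMap.lsmul ℝ ℝ) (hy j)

theorem IsJet.pow_smul (hh : ∀ i, h i ∈ Ioc (0 : ℝ) 1) (k : ℕ) {a : ι → E}
    (ha : UniformBigO h k fun i _ => a i) : IsJet h r fun i s => s ^ k • a i := by
  obtain ⟨C, -, hC⟩ := ha.exists_bound hh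
  refine .congr _ _ (.monomial k (fun i => (h i ^ k)⁻¹ • a i) (.of_bound C fun i s hs => ?_))
    fun i s _ => ?_
  · have hpos : 0 < h i ^ k := pow_pos (hh i).1 k
    rw [norm_smul, norm_inv, Real.norm_of_nonneg hpos.le, inv_mul_le_iff₀ hpos, pow_zero, mul_one,
      mul_comm]
    exact hC i s hs
  · rw [mul_pow, mul_comm, mul_smul, smul_inv_smul₀ (pow_ne_zero k (hh i).1.ne')]

theorem isJet_interp_of_uniformBigO (he : Function.Injective e) (hh : ∀ i, h i ∈ Ioc (0 : ℝ) 1)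
    {y : ι → Fin M → E} (hy : ∀ j, UniformBigO h M fun i _ => y i j) :
    IsJet h r fun i => SDC.interp e (y i) := by
  refine IsJet.sum _ fun j _ => ?_
  have hdeg : (Lagrange.basis Finset.univ e j).natDegree < M := by
    rw [Lagrange.natDegree_basis he.injOn (Finset.mem_univ j), Finset.card_univ, Fintype.card_fin]
    exact Nat.sub_lt j.pos one_pos
  refine .congr _ _ (.sum (Finset.range M) fun k hk => .pow_smul hh k
    (((hy j).of_le hh (Finset.mem_range.1 hk).le).const_smul
      ((Lagrange.basis Finset.univ e j).coeff k))) fun i s _ => ?_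
  simp only [Polynomial.eval_eq_sum_range' hdeg, Finset.sum_smul, smul_smul, mul_comm]

theorem IsJet.interp (he : Function.Injective e) (he01 : ∀ j, e j ∈ Icc (0 : ℝ) 1)
    (hh : ∀ i, h i ∈ Ioc (0 : ℝ) 1) (hr : M ≤ r) {φ : ι → ℝ → E} (hφ : IsJet h r φ) :
    IsJet h r fun i => SDC.interp e (φ i ∘ e) := by
  induction hφ with
  | monomial k a ha =>
    rcases lt_or_ge k M with hk | hk
    · exact .congr _ _ (.monomial k a ha) fun i s _ => interp_monomial he hk _ _ _
    · exact isJet_interp_of_uniformBigO he hh fun j =>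
        ((uniformBigO_monomial k ha).eval (he01 j)).of_le hh hk
  | remainder φ _ hb =>
    exact isJet_interp_of_uniformBigO he hh fun j => (hb.eval (he01 j)).of_le hh hr
  | add φ ψ _ _ h1 h2 => exact .congr _ _ (.add _ _ h1 h2) fun i s _ => interp_add _ _ _
  | congr φ ψ _ heq h1 =>
    refine .congr _ _ h1 fun i s _ => ?_
    rw [show ψ i ∘ e = φ i ∘ e from funext fun j => heq i (he01 j)]

theorem IsJet.interpError (he : Function.Injective e) (he01 : ∀ j, e j ∈ Icc (0 : ℝ) 1)
    (hh : ∀ i, h i ∈ Ioc (0 : ℝ) 1) (hr : M ≤ r) {φ : ι → ℝ → E} (hφ : IsJet h r φ) :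
    IsJet h r fun i => SDC.interpError e (φ i) :=
  hφ.sub (hφ.interp he he01 hh hr)

theorem UniformBigO.interpError (he01 : ∀ j, e j ∈ Icc (0 : ℝ) 1) {φ : ι → ℝ → E}
    (hφ : UniformBigO h r φ) : UniformBigO h r fun i => SDC.interpError e (φ i) :=
  hφ.sub (UniformBigO.interp fun j => hφ.eval (he01 j))

theorem IsJet.uniformBigO_interpError (he : Function.Injective e)
    (he01 : ∀ j, e j ∈ Icc (0 : ℝ) 1) (hh : ∀ i, h i ∈ Ioc (0 : ℝ) 1) {φ : ι → ℝ → E}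
    (hφ : IsJet h r φ) : UniformBigO h (min r M) fun i => SDC.interpError e (φ i) := by
  induction hφ with
  | monomial k a ha =>
    rcases lt_or_ge k M with hk | hk
    · exact .of_bound 0 fun i s _ => by
        simp [SDC.interpError, Function.comp_def, interp_monomial he hk]
    · exact ((uniformBigO_monomial k ha).of_le hh ((min_le_right r M).trans hk)).interpError he01
  | remainder φ _ hb => exact (hb.of_le hh (min_le_left r M)).interpError he01
  | add φ ψ _ _ h1 h2 =>
    exact (h1.add h2).congr fun i s _ => interpError_add (φ i) (ψ i) s
  | congr φ ψ _ heq h1 => exact h1.congr fun i => interpError_congr he01 (heq i)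

theorem QuadratureOrder.integral_interpError_monomial [CompleteSpace E] (hq : QuadratureOrder e r)
    {k : ℕ} (hk : k < r) (c : ℝ) (a : E) :
    ∫ s in (0 : ℝ)..1, interpError e (fun s => (c * s) ^ k • a) s = 0 := by
  have hX : ∑ j, weight e 1 j * e j ^ k = ∫ s in (0 : ℝ)..1, s ^ k := by
    simpa using hq (Polynomial.X ^ k) (by rw [Polynomial.degree_X_pow]; exact_mod_cast hk)
  rw [integral_interpError (Continuous.continuousOn (by fun_prop)) ⟨zero_le_one, le_rfl⟩,
    sub_eq_zero]
  simp only [mul_pow]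
  rw [intervalIntegral.integral_smul_const, intervalIntegral.integral_const_mul, ← hX,
    Finset.mul_sum, Finset.sum_smul]
  refine Finset.sum_congr rfl fun j _ => ?_
  rw [smul_smul]
  ring_nf

theorem IsJet.quadrature_error [CompleteSpace E] (he01 : ∀ j, e j ∈ Icc (0 : ℝ) 1)
    (hh : ∀ i, h i ∈ Ioc (0 : ℝ) 1) (hq : QuadratureOrder e r) {φ : ι → ℝ → E}
    (hφ : IsJet h r φ) :
    UniformBigO h r fun i _ => ∫ s in (0 : ℝ)..1, SDC.interpError e (φ i) s := by
  have hzero : (0 : ℝ) ∈ Icc (0 : ℝ) 1 := ⟨le_rfl, zero_le_one⟩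
  have hone : (1 : ℝ) ∈ Icc (0 : ℝ) 1 := ⟨zero_le_one, le_rfl⟩
  induction hφ with
  | monomial k a ha =>
    rcases lt_or_ge k r with hk | hk
    · exact .of_bound 0 fun i _ _ => by simp [hq.integral_interpError_monomial hk]
    · have hb := (uniformBigO_monomial k ha).of_le hh hk
      exact ((hb.interpError he01).integral hh hzero).eval hone
  | remainder φ _ hb => exact ((hb.interpError he01).integral hh hzero).eval hone
  | add φ ψ hφ hψ h1 h2 =>
    refine (h1.add h2).congr fun i s _ => ?_
    have hint {χ : ι → ℝ → E} (hχ : IsJet h r χ) :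
        IntervalIntegrable (SDC.interpError e (χ i)) volume 0 1 :=
      (hχ.intervalIntegrable i hzero hone).sub
        ((continuous_interp e _).intervalIntegrable _ _)
    simp only [Pi.add_apply]
    rw [← intervalIntegral.integral_add (hint hφ) (hint hψ)]
    exact intervalIntegral.integral_congr fun s _ => interpError_add (φ i) (ψ i) s
  | congr φ ψ _ heq h1 =>
    refine h1.congr fun i s _ => intervalIntegral.integral_congr fun s hs => ?_
    rw [uIcc_of_le zero_le_one] at hs
    exact interpError_congr he01 (heq i) hs

theorem IsJet.uniformBigO_integral_of_nodes [CompleteSpace E] (he01 : ∀ j, e j ∈ Icc (0 : ℝ) 1)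
    (hh : ∀ i, h i ∈ Ioc (0 : ℝ) 1) (hq : QuadratureOrder e r) {φ : ι → ℝ → E}
    (hφ : IsJet h r φ) (hnode : ∀ j, UniformBigO h r fun i _ => φ i (e j)) :
    UniformBigO h r fun i _ => ∫ s in (0 : ℝ)..1, φ i s := by
  refine ((hφ.quadrature_error he01 hh hq).add
    (UniformBigO.sum_weight_smul (e := e) 1 hnode)).congr fun i s _ => ?_
  rw [Pi.add_apply, Pi.add_apply, integral_interpError (hφ.continuousOn i) ⟨zero_le_one, le_rfl⟩,
    sub_add_cancel]

end Interpolation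

/-! ### Superconvergence for linear error equations -/

section Resolvent

variable {ι E : Type*} [NormedAddCommGroup E] [NormedSpace ℝ E] {r M : ℕ} {e : Fin M → ℝ}

/-- The Picard iterates, started from `0`, of the backward equation `B' = -h B J`, `B 1 = 1`, whose
solution expresses the error at the end of a step of size `h` through the defect of the error
equation `η' = h J η`. -/
noncomputable def approxResolvent (h : ℝ) (J : ℝ → E →L[ℝ] E) : ℕ → ℝ → E →L[ℝ] E
  | 0 => 0
  | n + 1 => fun s => 1 - h • ∫ σ in (1 : ℝ)..s, approxResolvent h J n σ * J σ

theorem approxResolvent_succ_one (h : ℝ) (J : ℝ → E →L[ℝ] E) (n : ℕ) :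
    approxResolvent h J (n + 1) 1 = 1 := by
  simp [approxResolvent]

theorem continuousOn_approxResolvent (h : ℝ) {J : ℝ → E →L[ℝ] E}
    (hJ : ContinuousOn J (Icc 0 1)) (n : ℕ) : ContinuousOn (approxResolvent h J n) (Icc 0 1) := by
  induction n with
  | zero => exact continuousOn_const
  | succ n ih =>
    have hint := continuousOn_integral (ih.mul hJ) ⟨zero_le_one, le_rfl⟩
    exact continuousOn_const.sub (hint.const_smul h)

theorem IsJet.approxResolvent [CompleteSpace E] {h : ι → ℝ} (hh : ∀ i, h i ∈ Ioc (0 : ℝ) 1)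
    {J : ι → ℝ → E →L[ℝ] E} (hJ : IsJet h r J) (n : ℕ) :
    IsJet h (r + 1) fun i => SDC.approxResolvent (h i) (J i) n := by
  have hconst (A : E →L[ℝ] E) : IsJet h (r + 1) fun _ _ => A :=
    .const (.of_bound ‖A‖ fun _ _ _ => by rw [pow_zero, mul_one])
  induction n with
  | zero => exact hconst 0
  | succ n ih =>
    exact (hconst 1).sub ((IsJet.bilin hh (ContinuousLinearMap.mul ℝ (E →L[ℝ] E))
      (ih.of_le hh r.le_succ) hJ).step_integral_from hh ⟨zero_le_one, le_rfl⟩)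

theorem uniformBigO_approxResolvent_sub {h : ι → ℝ} (hh : ∀ i, h i ∈ Ioc (0 : ℝ) 1)
    {J : ι → ℝ → E →L[ℝ] E} (hJ : IsJet h r J) (n : ℕ) :
    UniformBigO h n fun i =>
      approxResolvent (h i) (J i) (n + 1) - approxResolvent (h i) (J i) n := by
  have hone : (1 : ℝ) ∈ Icc (0 : ℝ) 1 := ⟨zero_le_one, le_rfl⟩
  induction n with
  | zero =>
    exact .of_bound ‖(1 : E →L[ℝ] E)‖ fun i s _ => by simp [approxResolvent]
  | succ n ih =>
    have hprod := ((ih.bilin (ContinuousLinearMap.mul ℝ (E →L[ℝ] E)) (hJ.uniformBigO hh)).integral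
      hh hone).step_pow_smul 1
    rw [add_zero, add_comm 1 n] at hprod
    refine (hprod.const_smul (-1)).congr fun i s hs => ?_
    have hint (m : ℕ) : IntervalIntegrable (fun σ => approxResolvent (h i) (J i) m σ * J i σ)
        volume 1 s :=
      (((continuousOn_approxResolvent (h i) (hJ.continuousOn i) m).mul (hJ.continuousOn i)).mono
        (uIcc_subset_Icc hone hs)).intervalIntegrable
    simp only [ContinuousLinearMap.mul_apply', Pi.sub_apply, sub_mul]
    rw [intervalIntegral.integral_sub (hint (n + 1)) (hint n), approxResolvent, approxResolvent]
    module

theorem hasDerivAt_integral_of_continuousOn [CompleteSpace E] {φ : ℝ → E}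
    (hφ : ContinuousOn φ (Icc 0 1)) {c s : ℝ} (hc : c ∈ Icc (0 : ℝ) 1) (hs : s ∈ Ioo (0 : ℝ) 1) :
    HasDerivAt (fun t => ∫ σ in c..t, φ σ) (φ s) s := by
  have hn : Icc (0 : ℝ) 1 ∈ nhds s := Icc_mem_nhds hs.1 hs.2
  refine intervalIntegral.integral_hasDerivAt_right
    ((hφ.mono (uIcc_subset_Icc hc (Ioo_subset_Icc_self hs))).intervalIntegrable) ?_
    (hφ.continuousAt hn)
  simpa only [nhdsWithin_eq_nhds.2 hn] using
    hφ.stronglyMeasurableAtFilter_nhdsWithin measurableSet_Icc s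

theorem hasDerivAt_approxResolvent_apply_integral [CompleteSpace E] (h : ℝ)
    {J : ℝ → E →L[ℝ] E} (hJ : ContinuousOn J (Icc 0 1)) {w : ℝ → E}
    (hw : ContinuousOn w (Icc 0 1)) (n : ℕ) {s : ℝ} (hs : s ∈ Ioo (0 : ℝ) 1) :
    HasDerivAt (fun s => approxResolvent h J (n + 1) s (h • ∫ σ in (0 : ℝ)..s, w σ))
      (h • (approxResolvent h J (n + 1) s (w s) -
        approxResolvent h J n s (J s (h • ∫ σ in (0 : ℝ)..s, w σ)))) s := by
  have hB : HasDerivAt (approxResolvent h J (n + 1)) (-(h • (approxResolvent h J n s * J s))) s :=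
    ((hasDerivAt_integral_of_continuousOn ((continuousOn_approxResolvent h hJ n).mul hJ)
      ⟨zero_le_one, le_rfl⟩ hs).const_smul h).const_sub 1
  refine (hB.clm_apply ((hasDerivAt_integral_of_continuousOn hw ⟨le_rfl, zero_le_one⟩
    hs).const_smul h)).congr_deriv ?_
  simp only [neg_apply, smul_apply, mul_apply_eq_comp, map_smul, Pi.smul_apply]
  module

theorem step_integral_eq_defect_add_remainder [CompleteSpace E] (h : ℝ)
    {J : ℝ → E →L[ℝ] E} (hJ : ContinuousOn J (Icc 0 1)) {w η : ℝ → E}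
    (hw : ContinuousOn w (Icc 0 1)) (hη : ∀ s, η s = h • ∫ σ in (0 : ℝ)..s, w σ) (n : ℕ) :
    η 1 = h • ((∫ s in (0 : ℝ)..1, approxResolvent h J (n + 1) s (w s - J s (η s))) +
      ∫ s in (0 : ℝ)..1, (approxResolvent h J (n + 1) - approxResolvent h J n) s (J s (η s))) := by
  obtain rfl : η = fun s => h • ∫ σ in (0 : ℝ)..s, w σ := funext hη
  set η : ℝ → E := fun s => h • ∫ σ in (0 : ℝ)..s, w σ
  have hηc : ContinuousOn η (Icc 0 1) :=
    continuousOn_const.smul (continuousOn_integral hw ⟨le_rfl, zero_le_one⟩)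
  have happly (m : ℕ) {φ : ℝ → E} (hφ : ContinuousOn φ (Icc 0 1)) :
      ContinuousOn (fun s => approxResolvent h J m s (φ s)) (Icc 0 1) :=
    (continuousOn_approxResolvent h hJ m).clm_apply hφ
  have hJη : ContinuousOn (fun s => J s (η s)) (Icc 0 1) := hJ.clm_apply hηc
  have hint {φ : ℝ → E} (hφ : ContinuousOn φ (Icc 0 1)) : IntervalIntegrable φ volume 0 1 :=
    (hφ.mono (uIcc_of_le zero_le_one).subset).intervalIntegrable
  have hfund := intervalIntegral.integral_eq_sub_of_hasDerivAt_of_le zero_le_one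
    (happly (n + 1) hηc) (fun s hs => hasDerivAt_approxResolvent_apply_integral h hJ hw n hs)
    (hint (((happly (n + 1) hw).sub (happly n hJη)).const_smul h))
  have hη0 : η 0 = 0 := by simp [η]
  rw [approxResolvent_succ_one, hη0, map_zero, sub_zero, one_apply_eq_self,
    intervalIntegral.integral_smul] at hfund
  have hdefect := happly (n + 1) (hw.sub hJη)
  simp only [Pi.sub_apply] at hdefect
  rw [← hfund, ← intervalIntegral.integral_add (hint hdefect)
    (hint (((continuousOn_approxResolvent h hJ (n + 1)).sub
      (continuousOn_approxResolvent h hJ n)).clm_apply hJη))]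
  congr 1
  refine intervalIntegral.integral_congr fun s _ => ?_
  simp only [map_sub, Pi.sub_apply, sub_apply, sub_add_sub_cancel]
  rfl

theorem uniformBigO_of_node_defect [CompleteSpace E] (he01 : ∀ j, e j ∈ Icc (0 : ℝ) 1)
    {h : ι → ℝ} (hh : ∀ i, h i ∈ Ioc (0 : ℝ) 1) (hq : QuadratureOrder e (r + 1))
    {J : ι → ℝ → E →L[ℝ] E} (hJ : IsJet h r J) {w η : ι → ℝ → E} (hw : IsJet h (r + 1) w)
    (hη : ∀ i s, η i s = h i • ∫ σ in (0 : ℝ)..s, w i σ)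
    (hdefect : ∀ j, UniformBigO h (r + 1) fun i _ => w i (e j) - J i (e j) (η i (e j))) :
    UniformBigO h (r + 2) fun i _ => η i 1 := by
  have hzero : (0 : ℝ) ∈ Icc (0 : ℝ) 1 := ⟨le_rfl, zero_le_one⟩
  have hone : (1 : ℝ) ∈ Icc (0 : ℝ) 1 := ⟨zero_le_one, le_rfl⟩
  let ev : (E →L[ℝ] E) →L[ℝ] E →L[ℝ] E := ContinuousLinearMap.id ℝ _
  have hηeq : ∀ i, EqOn (η i) (fun s => h i • ∫ σ in (0 : ℝ)..s, w i σ) (Icc 0 1) :=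
    fun i s _ => hη i s
  have hηJ : IsJet h (r + 1) η := ((hw.step_integral hh).of_le hh (r + 1).le_succ).congr _ _ hηeq
  have hη1 : UniformBigO h 1 η := by
    refine UniformBigO.congr ?_ hηeq
    simpa only [pow_one, add_zero] using ((hw.uniformBigO hh).integral hh hzero).step_pow_smul 1
  have hJη : IsJet h (r + 1) fun i s => J i s (η i s) := .bilin_of_uniformBigO_one hh ev hJ hηJ hη1
  have hB := hJ.approxResolvent hh (r + 2)
  have hdefects : UniformBigO h (r + 1) fun i _ =>
      ∫ s in (0 : ℝ)..1, approxResolvent (h i) (J i) (r + 2) s (w i s - J i s (η i s)) :=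
    (IsJet.bilin hh ev hB (hw.sub hJη)).uniformBigO_integral_of_nodes he01 hh hq fun j => by
      simpa only [zero_add, Pi.sub_apply] using
        ((hB.uniformBigO hh).eval (he01 j)).bilin ev (hdefect j)
  have hremainder := (((uniformBigO_approxResolvent_sub hh hJ (r + 1)).bilin ev
    (hJη.uniformBigO hh)).integral hh hzero).eval hone
  have hsum := (hdefects.add hremainder).step_pow_smul 1
  rw [add_comm 1 (r + 1)] at hsum
  refine hsum.congr fun i s _ => ?_
  rw [step_integral_eq_defect_add_remainder (h i) (hJ.continuousOn i) (hw.continuousOn i) (hη i)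
    (r + 1), pow_one]
  rfl

end Resolvent

/-! ### The local error of collocation -/

section TaylorRemainder

variable {E : Type*} [NormedAddCommGroup E] [NormedSpace ℝ E] {G : E → E} {L : NNReal} {y z : E}

theorem norm_sub_fderiv_le_of_closedBall {C : ℝ}
    (hG : ∀ w ∈ Metric.closedBall z ‖y - z‖, DifferentiableAt ℝ G w)
    (hG' : ∀ w ∈ Metric.closedBall z ‖y - z‖, DifferentiableAt ℝ (fderiv ℝ G) w)
    (hC : ∀ w ∈ Metric.closedBall z ‖y - z‖, ‖fderiv ℝ (fderiv ℝ G) w‖ ≤ C) :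
    ‖G y - G z - fderiv ℝ G z (y - z)‖ ≤ C * ‖y - z‖ ^ 2 := by
  have hz : z ∈ Metric.closedBall z ‖y - z‖ := Metric.mem_closedBall_self (norm_nonneg _)
  have hC0 : 0 ≤ C := (norm_nonneg _).trans (hC z hz)
  have hconv : Convex ℝ (Metric.closedBall z ‖y - z‖) := convex_closedBall _ _
  have hderiv : ∀ w ∈ Metric.closedBall z ‖y - z‖,
      ‖fderiv ℝ G w - fderiv ℝ G z‖ ≤ C * ‖y - z‖ := fun w hw =>
    (hconv.norm_image_sub_le_of_norm_fderiv_le (𝕜 := ℝ) hG' hC hz hw).trans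
      (mul_le_mul_of_nonneg_left (mem_closedBall_iff_norm.1 hw) hC0)
  rw [sq, ← mul_assoc]
  exact hconv.norm_image_sub_le_of_norm_fderiv_le' (𝕜 := ℝ) hG hderiv hz
    (mem_closedBall_iff_norm.2 le_rfl)

theorem norm_sub_fderiv_le_of_lipschitz (hL : LipschitzWith L G) {δ : ℝ} (hδ : 0 < δ)
    (hy : δ ≤ ‖y - z‖) :
    ‖G y - G z - fderiv ℝ G z (y - z)‖ ≤ 2 * L / δ * ‖y - z‖ ^ 2 := by
  have hlin : ‖fderiv ℝ G z (y - z)‖ ≤ L * ‖y - z‖ :=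
    (fderiv ℝ G z).le_of_opNorm_le (norm_fderiv_le_of_lipschitz ℝ hL) _
  calc ‖G y - G z - fderiv ℝ G z (y - z)‖ ≤ L * ‖y - z‖ + L * ‖y - z‖ :=
        (norm_sub_le _ _).trans (add_le_add (hL.norm_sub_le y z) hlin)
    _ = 2 * L / δ * (δ * ‖y - z‖) := by field_simp; ring
    _ ≤ 2 * L / δ * ‖y - z‖ ^ 2 := by rw [sq]; gcongr

theorem exists_quadratic_remainder [ProperSpace E] {U K : Set E}
    (hU : IsOpen U) (hK : IsCompact K) (hKU : K ⊆ U) (hG : ContDiffOn ℝ 2 G U)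
    (hL : LipschitzWith L G) :
    ∃ C : ℝ, ∀ z ∈ K, ∀ y, ‖G y - G z - fderiv ℝ G z (y - z)‖ ≤ C * ‖y - z‖ ^ 2 := by
  obtain ⟨δ, hδ, hsub⟩ := hK.exists_cthickening_subset_open hU hKU
  have hG1 : ContDiffOn ℝ 1 (fderiv ℝ G) U := hG.fderiv_of_isOpen hU (by norm_num)
  have hG2 : ContinuousOn (fderiv ℝ (fderiv ℝ G)) U :=
    hG1.continuousOn_fderiv_of_isOpen hU le_rfl
  obtain ⟨C, hC⟩ := (hK.cthickening (r := δ)).exists_bound_of_continuousOn (hG2.mono hsub)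
  refine ⟨max C (2 * L / δ), fun z hz y => ?_⟩
  rcases le_total δ ‖y - z‖ with hy | hy
  · exact (norm_sub_fderiv_le_of_lipschitz hL hδ hy).trans
      (mul_le_mul_of_nonneg_right (le_max_right _ _) (sq_nonneg _))
  · have hball : ∀ w ∈ Metric.closedBall z ‖y - z‖, w ∈ Metric.cthickening δ K := fun w hw =>
      Metric.mem_cthickening_of_dist_le w z δ K hz ((Metric.mem_closedBall.1 hw).trans hy)
    have hnhds (w) (hw : w ∈ Metric.closedBall z ‖y - z‖) : U ∈ nhds w :=
      hU.mem_nhds (hsub (hball w hw))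
    exact (norm_sub_fderiv_le_of_closedBall
      (fun w hw => (hG.contDiffAt (hnhds w hw)).differentiableAt two_ne_zero)
      (fun w hw => (hG1.contDiffAt (hnhds w hw)).differentiableAt one_ne_zero)
      fun w hw => hC w (hball w hw)).trans
      (mul_le_mul_of_nonneg_right (le_max_left _ _) (sq_nonneg _))

end TaylorRemainder

/-- The sum of the absolute values of all entries, as an upper bound for the operator norm. -/
noncomputable def absSum {κ κ' : Type*} [Fintype κ] [Fintype κ'] (A : Matrix κ κ' ℝ) : ℝ :=
  ∑ i, ∑ j, |A i j|

section AbsSum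

variable {κ κ' E : Type*} [Fintype κ] [Fintype κ'] [NormedAddCommGroup E] [NormedSpace ℝ E]

theorem absSum_nonneg (A : Matrix κ κ' ℝ) : 0 ≤ absSum A :=
  Finset.sum_nonneg fun _ _ => Finset.sum_nonneg fun _ _ => abs_nonneg _

theorem norm_sum_smul_le_absSum (A : Matrix κ κ' ℝ) {W : κ' → E} {B : ℝ} (hB : 0 ≤ B)
    (hW : ∀ j, ‖W j‖ ≤ B) (i : κ) : ‖∑ j, A i j • W j‖ ≤ absSum A * B :=
  calc ‖∑ j, A i j • W j‖ ≤ ∑ j, |A i j| * B := norm_sum_le_of_le _ fun j _ => by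
        rw [norm_smul, Real.norm_eq_abs]
        exact mul_le_mul_of_nonneg_left (hW j) (abs_nonneg _)
    _ = (∑ j, |A i j|) * B := by rw [Finset.sum_mul]
    _ ≤ absSum A * B := mul_le_mul_of_nonneg_right
        (Finset.single_le_sum (f := fun i => ∑ j, |A i j|)
          (fun _ _ => Finset.sum_nonneg fun _ _ => abs_nonneg _) (Finset.mem_univ i)) hB

theorem norm_le_of_linear_fixed_point (A : Matrix κ κ ℝ) {h K C : ℝ} (h0 : 0 ≤ h) (hK : 0 ≤ K)
    (hC : 0 ≤ C) (hsmall : h * (absSum A * K) ≤ 1 / 2) {D ψ ρ : κ → E}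
    (hD : ∀ i, D i = h • (∑ j, A i j • ψ j - ρ i)) (hψ : ∀ j, ‖ψ j‖ ≤ K * ‖D j‖)
    (hρ : ∀ i, ‖ρ i‖ ≤ C) (i : κ) : ‖D i‖ ≤ 2 * (h * C) := by
  have hbound : ‖D‖ ≤ h * (absSum A * K) * ‖D‖ + h * C := by
    have hA := absSum_nonneg A
    refine (pi_norm_le_iff_of_nonneg (by positivity)).2 fun i => ?_
    have hsum : ‖∑ j, A i j • ψ j‖ ≤ absSum A * (K * ‖D‖) :=
      norm_sum_smul_le_absSum A (by positivity)
        (fun j => (hψ j).trans (mul_le_mul_of_nonneg_left (norm_le_pi_norm D j) hK)) i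
    calc ‖D i‖ = h * ‖∑ j, A i j • ψ j - ρ i‖ := by rw [hD, norm_smul, Real.norm_of_nonneg h0]
      _ ≤ h * (absSum A * (K * ‖D‖) + C) :=
        mul_le_mul_of_nonneg_left ((norm_sub_le _ _).trans (add_le_add hsum (hρ i))) h0
      _ = h * (absSum A * K) * ‖D‖ + h * C := by ring
  have hhalf := mul_le_mul_of_nonneg_right hsmall (norm_nonneg D)
  exact (norm_le_pi_norm D i).trans (by linarith)

end AbsSum

theorem QuadratureOrder.le_two_mul {M p : ℕ} {e : Fin M → ℝ} (hq : QuadratureOrder e p) :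
    p ≤ 2 * M := by
  by_contra! hlt
  set ω := Lagrange.nodal Finset.univ e
  have hsquare : ∑ j, weight e 1 j * (ω ^ 2).eval (e j) = ∫ s in (0 : ℝ)..1, (ω ^ 2).eval s := by
    refine hq _ ?_
    rw [Polynomial.degree_pow, Lagrange.degree_nodal, Finset.card_univ, Fintype.card_fin,
      nsmul_eq_mul]
    exact_mod_cast hlt
  have hnodes : ∑ j, weight e 1 j * (ω ^ 2).eval (e j) = 0 := Finset.sum_eq_zero fun j _ => by
    rw [Polynomial.eval_pow, Lagrange.eval_nodal_at_node (Finset.mem_univ j),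
      zero_pow two_ne_zero, mul_zero]
  obtain ⟨c, hc, hc0⟩ : ∃ c ∈ Icc (0 : ℝ) 1, ω.eval c ≠ 0 := by
    by_contra! hall
    exact Lagrange.nodal_ne_zero (Polynomial.eq_zero_of_infinite_isRoot ω
      ((Icc_infinite zero_lt_one).mono hall))
  have hpos : 0 < ∫ s in (0 : ℝ)..1, (ω ^ 2).eval s :=
    intervalIntegral.integral_pos zero_lt_one (Polynomial.continuous _).continuousOn
      (fun s _ => by rw [Polynomial.eval_pow]; positivity)
      ⟨c, hc, by rw [Polynomial.eval_pow]; positivity⟩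
  exact hpos.ne (hnodes.symm.trans hsquare)

theorem contDiffOn_succ_of_hasDerivWithinAt {E : Type*} [NormedAddCommGroup E] [NormedSpace ℝ E]
    {u u' : ℝ → E} {a b : ℝ} (hab : a < b) {p : ℕ}
    (hu : ∀ s ∈ Icc a b, HasDerivWithinAt u (u' s) (Icc a b) s)
    (hu' : ContDiffOn ℝ p u' (Icc a b)) : ContDiffOn ℝ (p + 1) u (Icc a b) := by
  have hd : UniqueDiffOn ℝ (Icc a b) := uniqueDiffOn_Icc hab
  rw [contDiffOn_succ_iff_derivWithin hd]
  exact ⟨fun s hs => (hu s hs).differentiableWithinAt, by simp,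
    hu'.congr fun s hs => (hu s hs).derivWithin (hd s hs)⟩

section Collocation

variable {ι E : Type*} [NormedAddCommGroup E] [NormedSpace ℝ E]
  {M p r : ℕ} {e : Fin M → ℝ} {G : E → E} {u : ℝ → E} {a b : ℝ} {h t : ι → ℝ} {Y : ι → Fin M → E}

/-- `Y` are the stages of a collocation step of size `h` for `u' = G u` which starts at `y`. -/
def IsCollocationStages (e : Fin M → ℝ) (G : E → E) (h : ℝ) (y : E) (Y : Fin M → E) : Prop :=
  ∀ j, Y j = y + h • ∑ k, weight e (e j) k • G (Y k)

/-- The value at the end of a collocation step of size `h` for `u' = G u` with stages `Y` which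
starts at `y`. -/
noncomputable def collocationEnd (e : Fin M → ℝ) (G : E → E) (h : ℝ) (y : E) (Y : Fin M → E) : E :=
  y + h • ∑ k, weight e 1 k • G (Y k)

/-- A family of collocation steps for `u' = G u` with stages `Y`, each of which starts on the curve
`u`. -/
structure IsCollocationFamily (e : Fin M → ℝ) (G : E → E) (u : ℝ → E) (a b : ℝ) (h t : ι → ℝ)
    (Y : ι → Fin M → E) : Prop extends IsStepFamily a b h t where
  isCollocationStages (i : ι) : IsCollocationStages e G (h i) (u (t i)) (Y i)

/-- The difference at `t i + h i * s` between the collocation polynomial of step `i` and `u`. -/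
noncomputable def collocationError (e : Fin M → ℝ) (G : E → E) (u : ℝ → E) (h t : ι → ℝ)
    (Y : ι → Fin M → E) (i : ι) (s : ℝ) : E :=
  u (t i) + h i • ∑ k, weight e s k • G (Y i k) - u (t i + h i * s)

/-- The error at the nodes of the right hand side of the differential equation. -/
def stageError (e : Fin M → ℝ) (G : E → E) (u : ℝ → E) (h t : ι → ℝ) (Y : ι → Fin M → E) (i : ι) :
    Fin M → E :=
  fun j => G (Y i j) - G (u (t i + h i * e j))

theorem IsCollocationFamily.collocationError_node (hY : IsCollocationFamily e G u a b h t Y)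
    (i : ι) (j : Fin M) :
    collocationError e G u h t Y i (e j) = Y i j - u (t i + h i * e j) := by
  rw [collocationError, ← hY.isCollocationStages]

theorem IsCollocationFamily.norm_stageError_le (hY : IsCollocationFamily e G u a b h t Y)
    {K : NNReal} (hG : LipschitzWith K G) (i : ι) (j : Fin M) :
    ‖stageError e G u h t Y i j‖ ≤ K * ‖collocationError e G u h t Y i (e j)‖ := by
  rw [hY.collocationError_node]
  exact hG.norm_sub_le _ _

theorem IsStepFamily.collocationError_eq_sum [CompleteSpace E] (hst : IsStepFamily a b h t)
    (hu : ∀ s ∈ Icc a b, HasDerivWithinAt u (G (u s)) (Icc a b) s)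
    (hGu : ContinuousOn (fun s => G (u s)) (Icc a b)) (Y : ι → Fin M → E) (i : ι) {s : ℝ}
    (hs : s ∈ Icc (0 : ℝ) 1) :
    collocationError e G u h t Y i s = h i • (∑ k, weight e s k • stageError e G u h t Y i k -
      ∫ σ in (0 : ℝ)..s, interpError e (fun σ => G (u (t i + h i * σ))) σ) := by
  rw [integral_interpError (hst.continuousOn_comp hGu i) hs, smul_sub, smul_sub,
    hst.step_integral hu hGu i hs, collocationError]
  simp only [stageError, smul_sub, Finset.sum_sub_distrib]
  abel

theorem IsStepFamily.collocationError_eq_integral [CompleteSpace E] (hst : IsStepFamily a b h t)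
    (hu : ∀ s ∈ Icc a b, HasDerivWithinAt u (G (u s)) (Icc a b) s)
    (hGu : ContinuousOn (fun s => G (u s)) (Icc a b)) (Y : ι → Fin M → E) (i : ι) {s : ℝ}
    (hs : s ∈ Icc (0 : ℝ) 1) :
    collocationError e G u h t Y i s = h i • ∫ σ in (0 : ℝ)..s,
      (interp e (stageError e G u h t Y i) σ -
        interpError e (fun σ => G (u (t i + h i * σ))) σ) := by
  have hcont : ContinuousOn (interpError e fun σ => G (u (t i + h i * σ))) (uIcc 0 s) :=
    ((hst.continuousOn_comp hGu i).sub (continuous_interp e _).continuousOn).mono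
      (uIcc_subset_Icc ⟨le_rfl, zero_le_one⟩ hs)
  rw [intervalIntegral.integral_sub ((continuous_interp e _).intervalIntegrable _ _)
    hcont.intervalIntegrable, integral_interp, hst.collocationError_eq_sum hu hGu Y i hs]

theorem IsCollocationFamily.uniformBigO_node_error [CompleteSpace E]
    (hY : IsCollocationFamily e G u a b h t Y) (he01 : ∀ j, e j ∈ Icc (0 : ℝ) 1) {K : NNReal}
    (hG : LipschitzWith K G) (hu : ∀ s ∈ Icc a b, HasDerivWithinAt u (G (u s)) (Icc a b) s)
    (hGu : ContinuousOn (fun s => G (u s)) (Icc a b))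
    (hsmall : ∀ i, h i * (absSum (.of fun j => weight e (e j)) * K) ≤ 1 / 2)
    (hr : UniformBigO h r fun i => interpError e fun s => G (u (t i + h i * s))) (j : Fin M) :
    UniformBigO h (r + 1) fun i _ => collocationError e G u h t Y i (e j) := by
  obtain ⟨C, hC0, hC⟩ :=
    (hr.integral hY.step_mem (c := 0) ⟨le_rfl, zero_le_one⟩).exists_bound hY.step_mem
  refine .of_bound (2 * C) fun i _ _ => ?_
  have h0 : 0 ≤ h i := (hY.step_mem i).1.le
  calc ‖collocationError e G u h t Y i (e j)‖ ≤ 2 * (h i * (C * h i ^ r)) :=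
        norm_le_of_linear_fixed_point (.of fun j => weight e (e j)) h0 K.2 (by positivity)
          (hsmall i) (fun j => hY.collocationError_eq_sum hu hGu Y i (he01 j))
          (hY.norm_stageError_le hG i) (fun j => hC i (e j) (he01 j)) j
    _ = 2 * C * h i ^ (r + 1) := by ring

theorem IsStepFamily.uniformBigO_collocationError_of_stageError [CompleteSpace E]
    (hst : IsStepFamily a b h t) (hab : a < b) (he01 : ∀ j, e j ∈ Icc (0 : ℝ) 1)
    (hquad : QuadratureOrder e p)
    (hu : ∀ s ∈ Icc a b, HasDerivWithinAt u (G (u s)) (Icc a b) s)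
    (hreg : ContDiffOn ℝ p (fun s => G (u s)) (Icc a b))
    (hstage : ∀ j, UniformBigO h p fun i _ => stageError e G u h t Y i j) :
    UniformBigO h (p + 1) fun i _ => collocationError e G u h t Y i 1 := by
  have hdiff := (UniformBigO.sum_weight_smul (e := e) 1 hstage).sub
    ((hst.isJet_comp hab p hreg).quadrature_error he01 hst.step_mem hquad)
  have hstep := hdiff.step_pow_smul 1
  rw [add_comm 1 p] at hstep
  refine hstep.congr fun i _ _ => ?_
  simp only [hst.collocationError_eq_sum hu hreg.continuousOn Y i ⟨zero_le_one, le_rfl⟩, pow_one,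
    Pi.sub_apply]

theorem IsCollocationFamily.uniformBigO_node_defect [ProperSpace E]
    (hY : IsCollocationFamily e G u a b h t Y) (he01 : ∀ j, e j ∈ Icc (0 : ℝ) 1) {K : NNReal}
    (hG : LipschitzWith K G) {U : Set E} (hU : IsOpen U) (hGU : ContDiffOn ℝ 2 G U)
    (huU : MapsTo u (Icc a b) U) (hu : ContinuousOn u (Icc a b)) {j : Fin M}
    (hnode : UniformBigO h r fun i _ => collocationError e G u h t Y i (e j)) :
    UniformBigO h (r + r) fun i _ => stageError e G u h t Y i j -
      fderiv ℝ G (u (t i + h i * e j)) (collocationError e G u h t Y i (e j)) := by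
  obtain ⟨C, hC⟩ := exists_quadratic_remainder hU (isCompact_Icc.image_of_continuousOn hu)
    (image_subset_iff.2 huU) hGU hG
  have hsq : UniformBigO h (r + r) fun i _ => ‖collocationError e G u h t Y i (e j)‖ *
      ‖collocationError e G u h t Y i (e j)‖ :=
    UniformBigO.bilin (ContinuousLinearMap.mul ℝ ℝ) hnode.norm_left hnode.norm_left
  refine hsq.of_norm_le C fun i _ _ => ?_
  rw [Real.norm_of_nonneg (mul_self_nonneg _), ← sq, hY.collocationError_node]
  exact hC _ (mem_image_of_mem u (hY.mapsTo i (he01 j))) _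

theorem IsCollocationFamily.uniformBigO_collocationError_of_smooth [ProperSpace E]
    (hY : IsCollocationFamily e G u a b h t Y) (hab : a < b) (he : Function.Injective e)
    (he01 : ∀ j, e j ∈ Icc (0 : ℝ) 1) (hquad : QuadratureOrder e p) (hp : M + 1 < p) {K : NNReal}
    (hG : LipschitzWith K G) (hu : ∀ s ∈ Icc a b, HasDerivWithinAt u (G (u s)) (Icc a b) s)
    (hreg : ContDiffOn ℝ p (fun s => G (u s)) (Icc a b)) {U : Set E} (hU : IsOpen U)
    (huU : MapsTo u (Icc a b) U) (hGU : ContDiffOn ℝ p G U)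
    (hnode : ∀ j, UniformBigO h (M + 1) fun i _ => collocationError e G u h t Y i (e j)) :
    UniformBigO h (p + 1) fun i _ => collocationError e G u h t Y i 1 := by
  have hp2M := hquad.le_two_mul
  obtain ⟨r, rfl⟩ : ∃ r, p = r + 1 := ⟨p - 1, by lia⟩
  have hu_smooth : ContDiffOn ℝ r u (Icc a b) :=
    (contDiffOn_succ_of_hasDerivWithinAt hab hu hreg).of_le (by norm_cast; lia)
  have hstage (j : Fin M) : UniformBigO h M fun i _ => stageError e G u h t Y i j :=
    ((hnode j).of_norm_le K fun i _ _ => hY.norm_stageError_le hG i j).of_le hY.step_mem M.le_succ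
  have hw : IsJet h (r + 1) fun i s => interp e (stageError e G u h t Y i) s -
      interpError e (fun s => G (u (t i + h i * s))) s :=
    (isJet_interp_of_uniformBigO he hY.step_mem hstage).sub
      ((hY.isJet_comp hab (r + 1) hreg).interpError he he01 hY.step_mem (by lia))
  have hJ : IsJet h r fun i s => fderiv ℝ G (u (t i + h i * s)) :=
    hY.isJet_comp hab r (g := fun s => fderiv ℝ G (u s))
      ((hGU.fderiv_of_isOpen hU (by norm_cast)).comp hu_smooth huU)
  refine (uniformBigO_of_node_defect he01 hY.step_mem hquad hJ hw (fun _ _ => rfl)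
    fun j => ?_).congr fun i s _ =>
      hY.collocationError_eq_integral hu hreg.continuousOn Y i ⟨zero_le_one, le_rfl⟩
  refine ((hY.uniformBigO_node_defect he01 hG hU (hGU.of_le (by norm_cast; lia)) huU
    hu_smooth.continuousOn (hnode j)).of_le hY.step_mem (by lia)).congr fun i s _ => ?_
  simp only [interpError, interp_node he, Function.comp_apply, sub_self, sub_zero]
  rw [hY.collocationError_eq_integral hu hreg.continuousOn Y i (he01 j)]
  rfl

theorem IsCollocationFamily.uniformBigO_collocationError [ProperSpace E]
    (hY : IsCollocationFamily e G u a b h t Y) (hab : a < b) (he : Function.Injective e)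
    (he01 : ∀ j, e j ∈ Icc (0 : ℝ) 1) (hquad : QuadratureOrder e p) {K : NNReal}
    (hG : LipschitzWith K G) (hu : ∀ s ∈ Icc a b, HasDerivWithinAt u (G (u s)) (Icc a b) s)
    (hreg : ContDiffOn ℝ p (fun s => G (u s)) (Icc a b))
    (hsmooth : M + 1 < p → ∃ U : Set E, IsOpen U ∧ MapsTo u (Icc a b) U ∧ ContDiffOn ℝ p G U)
    (hsmall : ∀ i, h i * (absSum (.of fun j => weight e (e j)) * K) ≤ 1 / 2) :
    UniformBigO h (p + 1) fun i _ => collocationError e G u h t Y i 1 := by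
  have hnode (j : Fin M) :=
    hY.uniformBigO_node_error he01 hG hu hreg.continuousOn hsmall
      ((hY.isJet_comp hab p hreg).uniformBigO_interpError he he01 hY.step_mem) j
  rcases lt_or_ge (M + 1) p with hp | hp
  · obtain ⟨U, hU, huU, hGU⟩ := hsmooth hp
    rw [min_eq_right (by lia)] at hnode
    exact hY.uniformBigO_collocationError_of_smooth hab he he01 hquad hp hG hu hreg hU huU hGU hnode
  · refine hY.uniformBigO_collocationError_of_stageError hab he01 hquad hu hreg fun j => ?_
    exact ((hnode j).of_norm_le K fun i _ _ => hY.norm_stageError_le hG i j).of_le hY.step_mem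
      (by lia)

theorem eventually_nhdsGT_zero_iff {P : ℝ → Prop} :
    (∀ᶠ h in 𝓝[>] 0, P h) ↔ ∃ h₀, 0 < h₀ ∧ ∀ h, 0 < h → h ≤ h₀ → P h := by
  simp only [Filter.Eventually, mem_nhdsGT_iff_exists_Ioc_subset, subset_def, mem_Ioc, mem_Ioi,
    mem_ofPred_eq, and_imp]

theorem eventually_mul_le_half (B : ℝ) : ∀ᶠ h : ℝ in 𝓝[>] 0, h * B ≤ 1 / 2 := by
  have hlim : Tendsto (fun h : ℝ => h * B) (𝓝[>] 0) (𝓝 (0 * B)) :=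
    (tendsto_id.mono_left nhdsWithin_le_nhds).mul_const B
  rw [zero_mul] at hlim
  exact hlim.eventually_le_const one_half_pos

theorem eventually_pos_and_le_one : ∀ᶠ h : ℝ in 𝓝[>] 0, 0 < h ∧ h ≤ 1 :=
  eventually_nhdsGT_zero_iff.2 ⟨1, one_pos, fun _ h0 h1 => ⟨h0, h1⟩⟩

theorem collocation_local_error [ProperSpace E] (he : Function.Injective e)
    (he01 : ∀ j, e j ∈ Icc (0 : ℝ) 1) (hquad : QuadratureOrder e p) {K : NNReal}
    (hG : LipschitzWith K G) (hab : a < b)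
    (hu : ∀ s ∈ Icc a b, HasDerivWithinAt u (G (u s)) (Icc a b) s)
    (hreg : ContDiffOn ℝ p (fun s => G (u s)) (Icc a b))
    (hsmooth : M + 1 < p → ∃ U : Set E, IsOpen U ∧ MapsTo u (Icc a b) U ∧ ContDiffOn ℝ p G U) :
    ∃ C, ∀ᶠ h : ℝ in 𝓝[>] 0, ∀ t, a ≤ t → t + h ≤ b → ∀ Y, IsCollocationStages e G h (u t) Y →
      ‖collocationEnd e G h (u t) Y - u (t + h)‖ ≤ C * h ^ (p + 1) := by
  obtain ⟨h₀, h₀_pos, hsmall⟩ := eventually_nhdsGT_zero_iff.1 (eventually_pos_and_le_one.and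
    (eventually_mul_le_half (absSum (.of fun j => weight e (e j)) * K)))
  -- All admissible steps form a single family, so that the uniform bound covers them at once.
  let ι := {i : ℝ × ℝ × (Fin M → E) // (0 < i.1 ∧ i.1 ≤ h₀) ∧ (a ≤ i.2.1 ∧ i.2.1 + i.1 ≤ b) ∧
    IsCollocationStages e G i.1 (u i.2.1) i.2.2}
  have hY : IsCollocationFamily e G u a b (fun i : ι => i.1.1) (fun i => i.1.2.1)
      fun i => i.1.2.2 :=
    { step_mem := fun i => (hsmall _ i.2.1.1 i.2.1.2).1
      left_le := fun i => i.2.2.1.1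
      right_le := fun i => i.2.2.1.2
      isCollocationStages := fun i => i.2.2.2 }
  obtain ⟨C, -, hC⟩ := (hY.uniformBigO_collocationError hab he he01 hquad hG hu hreg hsmooth
    fun i => (hsmall _ i.2.1.1 i.2.1.2).2).exists_bound hY.step_mem
  refine ⟨C, eventually_nhdsGT_zero_iff.2 ⟨h₀, h₀_pos, fun h h0 hle t hat htb Y hstage => ?_⟩⟩
  simpa only [collocationError, collocationEnd, mul_one] using
    hC ⟨(h, t, Y), ⟨h0, hle⟩, ⟨hat, htb⟩, hstage⟩ 1 ⟨zero_le_one, le_rfl⟩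

theorem norm_add_smul_sum_sub_le {κ κ' : Type*} [Fintype κ] [Fintype κ'] (A : Matrix κ κ' ℝ)
    {h : ℝ} (h0 : 0 < h) {K : NNReal} (hG : LipschitzWith K G) (y z : E) (Y Z : κ' → E) (i : κ) :
    ‖(y + h • ∑ k, A i k • G (Y k)) - (z + h • ∑ k, A i k • G (Z k))‖ ≤
      ‖y - z‖ + h * (absSum A * K) * ‖Y - Z‖ := by
  have hsum : ‖∑ k, A i k • (G (Y k) - G (Z k))‖ ≤ absSum A * (K * ‖Y - Z‖) :=
    norm_sum_smul_le_absSum A (by positivity) (fun k => (hG.norm_sub_le _ _).trans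
      (mul_le_mul_of_nonneg_left (norm_le_pi_norm (Y - Z) k) K.2)) i
  calc ‖(y + h • ∑ k, A i k • G (Y k)) - (z + h • ∑ k, A i k • G (Z k))‖
      = ‖y - z + h • ∑ k, A i k • (G (Y k) - G (Z k))‖ := by
        simp only [add_sub_add_comm, smul_sub, Finset.sum_sub_distrib]
    _ ≤ ‖y - z‖ + h * (absSum A * (K * ‖Y - Z‖)) := norm_add_le_of_le le_rfl <| by
        rw [norm_smul, Real.norm_of_nonneg h0.le]
        gcongr
    _ = ‖y - z‖ + h * (absSum A * K) * ‖Y - Z‖ := by ring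

theorem IsCollocationStages.norm_sub_le {h : ℝ} (h0 : 0 < h) {K : NNReal}
    (hsmall : h * (absSum (.of fun j => weight e (e j)) * K) ≤ 1 / 2) (hG : LipschitzWith K G)
    {y z : E} {Y Z : Fin M → E} (hY : IsCollocationStages e G h y Y)
    (hZ : IsCollocationStages e G h z Z) : ‖Y - Z‖ ≤ 2 * ‖y - z‖ := by
  set A : Matrix (Fin M) (Fin M) ℝ := .of fun j => weight e (e j)
  have hbound : ‖Y - Z‖ ≤ ‖y - z‖ + h * (absSum A * K) * ‖Y - Z‖ := by
    have hA := absSum_nonneg A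
    refine (pi_norm_le_iff_of_nonneg (by positivity)).2 fun j => ?_
    rw [Pi.sub_apply, hY j, hZ j]
    exact norm_add_smul_sum_sub_le A h0 hG y z Y Z j
  have hhalf := mul_le_mul_of_nonneg_right hsmall (norm_nonneg (Y - Z))
  linarith

theorem exists_lipschitz_collocationEnd (e : Fin M → ℝ) {K : NNReal} (hG : LipschitzWith K G) :
    ∃ C, 0 ≤ C ∧ ∀ᶠ h : ℝ in 𝓝[>] 0, ∀ y z Y Z, IsCollocationStages e G h y Y →
      IsCollocationStages e G h z Z →
      ‖collocationEnd e G h y Y - collocationEnd e G h z Z‖ ≤ (1 + C * h) * ‖y - z‖ := by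
  set B : Matrix Unit (Fin M) ℝ := .of fun _ => weight e 1
  have hB := absSum_nonneg B
  refine ⟨2 * (absSum B * K), by positivity, ?_⟩
  filter_upwards [self_mem_nhdsWithin,
    eventually_mul_le_half (absSum (.of fun j => weight e (e j)) * K)]
    with h (h0 : 0 < h) hsmall y z Y Z hY hZ
  calc ‖collocationEnd e G h y Y - collocationEnd e G h z Z‖
      ≤ ‖y - z‖ + h * (absSum B * K) * ‖Y - Z‖ := norm_add_smul_sum_sub_le B h0 hG y z Y Z ()
    _ ≤ ‖y - z‖ + h * (absSum B * K) * (2 * ‖y - z‖) := by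
        gcongr
        exact hY.norm_sub_le h0 hsmall hG hZ
    _ = (1 + 2 * (absSum B * K) * h) * ‖y - z‖ := by ring

end Collocation

/-! ### Implicit equations for the forces -/

section Action

variable {n d : ℕ} {f : Vec d × Vec d → Vec d} {L : NNReal} {A B : Matrix (Fin n) (Fin n) ℝ}
  {W Z X V X' V' : Fin n → Vec d}

theorem act_add : act A (W + Z) = act A W + act A Z := by
  funext m
  simp only [act, Pi.add_apply, smul_add, Finset.sum_add_distrib]

theorem act_sub : act A (W - Z) = act A W - act A Z := by
  funext m
  simp only [act, Pi.sub_apply, smul_sub, Finset.sum_sub_distrib]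

theorem sub_act : act (A - B) W = act A W - act B W := by
  funext m
  simp only [act, Matrix.sub_apply, Pi.sub_apply, sub_smul, Finset.sum_sub_distrib]

theorem act_smul (c : ℝ) : act A (c • W) = c • act A W := by
  funext m
  simp only [act, Pi.smul_apply, Finset.smul_sum, smul_comm c]

theorem act_mul : act (A * B) W = act A (act B W) := by
  funext m
  simp only [act, Matrix.mul_apply, Finset.sum_smul, Finset.smul_sum, smul_smul]
  exact Finset.sum_comm

theorem sum_vecMul_smul (c : Fin n → ℝ) :
    ∑ m, (Matrix.vecMul c A) m • W m = ∑ l, c l • act A W l := by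
  simp only [act, Matrix.vecMul, dotProduct, Finset.sum_smul, Finset.smul_sum, smul_smul]
  exact Finset.sum_comm

theorem norm_act_le : ‖act A W‖ ≤ absSum A * ‖W‖ :=
  (pi_norm_le_iff_of_nonneg (mul_nonneg (absSum_nonneg A) (norm_nonneg W))).2 fun i =>
    norm_sum_smul_le_absSum A (norm_nonneg W) (norm_le_pi_norm W) i

theorem norm_force_sub_le (hf : LipschitzWith L f) :
    ‖force f X V - force f X' V'‖ ≤ L * max ‖X - X'‖ ‖V - V'‖ := by
  refine (pi_norm_le_iff_of_nonneg (by positivity)).2 fun m => (hf.norm_sub_le _ _).trans ?_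
  gcongr
  exact max_le_max (norm_le_pi_norm (X - X') m) (norm_le_pi_norm (V - V') m)

theorem force_eq_of_indep (hind : ∀ y w w', f (y, w) = f (y, w')) : force f X V = force f X V' :=
  funext fun _ => hind _ _ _

end Action

section ImplicitEquations

variable {n d : ℕ} {f : Vec d × Vec d → Vec d} {L : NNReal} {h : ℝ}
  {A B : Matrix (Fin n) (Fin n) ℝ} {a b a' b' X V X' V' : Fin n → Vec d}

/-- The form shared by the collocation equations and the equations of one SDC iteration; `A` and `B`
are the matrices of the position and of the velocity, `a` and `b` the data. -/
def IsImplicitSolution (A B : Matrix (Fin n) (Fin n) ℝ) (f : Vec d × Vec d → Vec d) (h : ℝ)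
    (a b X V : Fin n → Vec d) : Prop :=
  X = a + h ^ 2 • act A (force f X V) ∧ V = b + h • act B (force f X V)

/-- A step size for which `IsImplicitSolution` is a fixed point equation for the forces with
contraction factor `1 / 2`, where `L` is a Lipschitz constant of the forces. -/
structure IsContractiveStep (A B : Matrix (Fin n) (Fin n) ℝ) (L : NNReal) (h : ℝ) : Prop where
  pos : 0 < h
  le_one : h ≤ 1
  mul_le_half : h * (L * (absSum A + absSum B)) ≤ 1 / 2

theorem eventually_isContractiveStep (A B : Matrix (Fin n) (Fin n) ℝ) (L : NNReal) :
    ∀ᶠ h in 𝓝[>] 0, IsContractiveStep A B L h := by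
  filter_upwards [eventually_pos_and_le_one, eventually_mul_le_half (L * (absSum A + absSum B))]
    with h hpos hhalf using ⟨hpos.1, hpos.2, hhalf⟩

/-- The map whose fixed points are the forces of the solutions of `IsImplicitSolution`. -/
def forceMap (A B : Matrix (Fin n) (Fin n) ℝ) (f : Vec d × Vec d → Vec d) (h : ℝ)
    (a b W : Fin n → Vec d) : Fin n → Vec d :=
  force f (a + h ^ 2 • act A W) (b + h • act B W)

theorem IsImplicitSolution.forceMap_eq (hX : IsImplicitSolution A B f h a b X V) :
    forceMap A B f h a b (force f X V) = force f X V := by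
  rw [forceMap, ← hX.1, ← hX.2]

theorem norm_add_smul_act_sub_le {c : ℝ} (hc : 0 ≤ c) (a a' W W' : Fin n → Vec d) :
    ‖(a + c • act A W) - (a' + c • act A W')‖ ≤ ‖a - a'‖ + c * (absSum A * ‖W - W'‖) := by
  rw [add_sub_add_comm, ← smul_sub, ← act_sub]
  refine norm_add_le_of_le le_rfl ?_
  rw [norm_smul, Real.norm_of_nonneg hc]
  exact mul_le_mul_of_nonneg_left norm_act_le hc

theorem IsContractiveStep.norm_forceMap_sub_le (hs : IsContractiveStep A B L h)
    (hf : LipschitzWith L f) (W W' : Fin n → Vec d) :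
    ‖forceMap A B f h a b W - forceMap A B f h a' b' W'‖ ≤
      L * max ‖a - a'‖ ‖b - b'‖ + 1 / 2 * ‖W - W'‖ := by
  have h0 := hs.pos.le
  have hA := absSum_nonneg A
  have hB := absSum_nonneg B
  have hsq : h ^ 2 ≤ h := pow_le_of_le_one h0 hs.le_one two_ne_zero
  have hposition : ‖(a + h ^ 2 • act A W) - (a' + h ^ 2 • act A W')‖ ≤
      max ‖a - a'‖ ‖b - b'‖ + h * ((absSum A + absSum B) * ‖W - W'‖) := by
    refine (norm_add_smul_act_sub_le (by positivity) _ _ _ _).trans ?_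
    gcongr
    exacts [le_max_left _ _, le_add_of_nonneg_right hB]
  have hvelocity : ‖(b + h • act B W) - (b' + h • act B W')‖ ≤
      max ‖a - a'‖ ‖b - b'‖ + h * ((absSum A + absSum B) * ‖W - W'‖) := by
    refine (norm_add_smul_act_sub_le h0 _ _ _ _).trans ?_
    gcongr
    exacts [le_max_right _ _, le_add_of_nonneg_left hA]
  calc ‖forceMap A B f h a b W - forceMap A B f h a' b' W'‖
      ≤ L * (max ‖a - a'‖ ‖b - b'‖ + h * ((absSum A + absSum B) * ‖W - W'‖)) :=
        (norm_force_sub_le hf).trans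
          (mul_le_mul_of_nonneg_left (max_le hposition hvelocity) L.2)
    _ = L * max ‖a - a'‖ ‖b - b'‖ + h * (L * (absSum A + absSum B)) * ‖W - W'‖ := by ring
    _ ≤ L * max ‖a - a'‖ ‖b - b'‖ + 1 / 2 * ‖W - W'‖ := by
        gcongr
        exact hs.mul_le_half

theorem IsImplicitSolution.norm_force_sub_le (hs : IsContractiveStep A B L h)
    (hf : LipschitzWith L f) (hX : IsImplicitSolution A B f h a b X V)
    (hX' : IsImplicitSolution A B f h a' b' X' V') :
    ‖force f X V - force f X' V'‖ ≤ 2 * L * max ‖a - a'‖ ‖b - b'‖ := by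
  have hle := hs.norm_forceMap_sub_le hf (a := a) (b := b) (a' := a') (b' := b')
    (force f X V) (force f X' V')
  rw [hX.forceMap_eq, hX'.forceMap_eq] at hle
  linarith

theorem IsImplicitSolution.norm_force_sub_le_of_indep (hs : IsContractiveStep A B L h)
    (hf : LipschitzWith L f) (hind : ∀ y w w', f (y, w) = f (y, w'))
    (hX : IsImplicitSolution A B f h a b X V) (hX' : IsImplicitSolution A B f h a' b' X' V') :
    ‖force f X V - force f X' V'‖ ≤ 2 * L * ‖a - a'‖ := by
  have hshift : IsImplicitSolution A B f h a' b X' (b + h • act B (force f X' V')) := by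
    have hforce : force f X' (b + h • act B (force f X' V')) = force f X' V' :=
      force_eq_of_indep hind
    exact ⟨by rw [hforce]; exact hX'.1, by rw [hforce]⟩
  have hle := hX.norm_force_sub_le hs hf hshift
  rwa [force_eq_of_indep (X := X') (V' := V') hind, sub_self, norm_zero,
    max_eq_left (norm_nonneg _)] at hle

theorem existsUnique_isImplicitSolution (hs : IsContractiveStep A B L h) (hf : LipschitzWith L f)
    (a b : Fin n → Vec d) :
    ∃! Z : (Fin n → Vec d) × (Fin n → Vec d), IsImplicitSolution A B f h a b Z.1 Z.2 := by
  have hcontracting : ContractingWith (1 / 2) (forceMap A B f h a b) := by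
    refine ⟨by norm_num, LipschitzWith.of_dist_le_mul fun W W' => ?_⟩
    simpa [dist_eq_norm] using hs.norm_forceMap_sub_le hf (a := a) (b := b) (a' := a) (b' := b) W W'
  obtain ⟨W, hW⟩ : ∃ W, forceMap A B f h a b W = W :=
    ⟨_, hcontracting.fixedPoint_isFixedPt⟩
  refine ⟨(a + h ^ 2 • act A W, b + h • act B W), ?_, fun Z hZ => ?_⟩
  · rw [forceMap] at hW
    exact ⟨by rw [hW], by rw [hW]⟩
  · have hforce : force f Z.1 Z.2 = W := hcontracting.fixedPoint_unique' hZ.forceMap_eq hW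
    refine Prod.ext ?_ ?_
    · rw [hZ.1, hforce]
    · rw [hZ.2, hforce]

end ImplicitEquations

/-! ### Steps of SDC -/

section Steps

variable {M d : ℕ} {e : Fin M → ℝ} {f : Vec d × Vec d → Vec d} {L : NNReal} {h : ℝ} {k : ℕ}
  {x₀ v₀ : Vec d} {X V : Fin (M + 1) → Vec d}

theorem isSweep_iff {X' V' : Fin (M + 1) → Vec d} :
    IsSweep e f h x₀ v₀ X V X' V' ↔ IsImplicitSolution (Qx e) (QT e) f h
      ((fun _ => x₀) + h • act (Q e) (fun _ => v₀) +
        h ^ 2 • act (Q e * Q e - Qx e) (force f X V))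
      ((fun _ => v₀) + h • act (Q e - QT e) (force f X V)) X' V' := by
  rw [IsSweep, IsImplicitSolution, sub_eq_iff_eq_add, sub_eq_iff_eq_add]

theorem IsCollocationSolution.isSweep (hX : IsCollocationSolution e f h x₀ v₀ X V) :
    IsSweep e f h x₀ v₀ X V X V := by
  constructor
  · nth_rewrite 1 [hX.1]
    rw [sub_act, smul_sub, add_sub_assoc]
  · nth_rewrite 1 [hX.2]
    rw [sub_act, smul_sub, add_sub_assoc]

theorem exists_isCollocationSolution (hs : IsContractiveStep (Q e * Q e) (Q e) L h)
    (hf : LipschitzWith L f) (x₀ v₀ : Vec d) :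
    ∃ X V, IsCollocationSolution e f h x₀ v₀ X V := by
  obtain ⟨Z, hZ, -⟩ := existsUnique_isImplicitSolution hs hf
    ((fun _ => x₀) + h • act (Q e) fun _ => v₀) fun _ => v₀
  exact ⟨Z.1, Z.2, hZ⟩

theorem exists_sweepMap (hs : IsContractiveStep (Qx e) (QT e) L h) (hf : LipschitzWith L f)
    (x₀ v₀ : Vec d) :
    ∃ Ψ : (Fin (M + 1) → Vec d) × (Fin (M + 1) → Vec d) →
        (Fin (M + 1) → Vec d) × (Fin (M + 1) → Vec d),
      ∀ Z Z', IsSweep e f h x₀ v₀ Z.1 Z.2 Z'.1 Z'.2 ↔ Z' = Ψ Z := by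
  choose Ψ hΨ hunique using fun Z : (Fin (M + 1) → Vec d) × (Fin (M + 1) → Vec d) =>
    existsUnique_isImplicitSolution hs hf
      ((fun _ => x₀) + h • act (Q e) (fun _ => v₀) +
        h ^ 2 • act (Q e * Q e - Qx e) (force f Z.1 Z.2))
      ((fun _ => v₀) + h • act (Q e - QT e) (force f Z.1 Z.2))
  refine ⟨Ψ, fun Z Z' => isSweep_iff.trans ⟨hunique Z Z', ?_⟩⟩
  rintro rfl
  exact hΨ Z

/-- `(X i, V i)`, `i ≤ k`, are the iterates of SDC. -/
def IsIteration (e : Fin M → ℝ) (f : Vec d × Vec d → Vec d) (k : ℕ) (h : ℝ) (x₀ v₀ : Vec d)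
    (X V : ℕ → Fin (M + 1) → Vec d) : Prop :=
  ∀ i < k, IsSweep e f h x₀ v₀ (X i) (V i) (X (i + 1)) (V (i + 1))

/-- The position and the velocity at the end of a step with the forces `W` at the nodes. -/
noncomputable def stepEnd (e : Fin M → ℝ) (h : ℝ) (x₀ v₀ : Vec d) (W : Fin (M + 1) → Vec d) :
    Vec d × Vec d :=
  (x₀ + h • ∑ m, q e m • v₀ + h ^ 2 • ∑ m, (Matrix.vecMul (q e) (Q e)) m • W m,
    v₀ + h • ∑ m, q e m • W m)

theorem isStep_iff {X₀ V₀ : Fin (M + 1) → Vec d} {z : Vec d × Vec d} :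
    IsStep e f k h X₀ V₀ x₀ v₀ z.1 z.2 ↔ ∃ X V : ℕ → Fin (M + 1) → Vec d,
      X 0 = X₀ ∧ V 0 = V₀ ∧ IsIteration e f k h x₀ v₀ X V ∧
        z = stepEnd e h x₀ v₀ (force f (X k) (V k)) := by
  simp only [IsStep, IsIteration, stepEnd, force, Prod.ext_iff]

theorem exists_stepMap (hs : IsContractiveStep (Qx e) (QT e) L h) (hf : LipschitzWith L f) (k : ℕ)
    (X₀ V₀ : Fin (M + 1) → Vec d) (x₀ v₀ : Vec d) :
    ∃ y : Vec d × Vec d, ∀ z : Vec d × Vec d, IsStep e f k h X₀ V₀ x₀ v₀ z.1 z.2 ↔ z = y := by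
  obtain ⟨Ψ, hΨ⟩ := exists_sweepMap hs hf x₀ v₀
  refine ⟨stepEnd e h x₀ v₀ (force f (Ψ^[k] (X₀, V₀)).1 (Ψ^[k] (X₀, V₀)).2), fun z => ?_⟩
  rw [isStep_iff]
  constructor
  · rintro ⟨X, V, rfl, rfl, hXV, rfl⟩
    have hiterate : ∀ i ≤ k, (X i, V i) = Ψ^[i] (X 0, V 0) := by
      intro i
      induction i with
      | zero => exact fun _ => rfl
      | succ i ih =>
        intro hi
        rw [Function.iterate_succ_apply', ← ih (Nat.le_of_succ_le hi)]
        exact (hΨ (X i, V i) (X (i + 1), V (i + 1))).1 (hXV i hi)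
    rw [← hiterate k le_rfl]
  · refine fun hz => ⟨fun i => (Ψ^[i] (X₀, V₀)).1, fun i => (Ψ^[i] (X₀, V₀)).2, rfl, rfl,
      fun i _ => ?_, hz⟩
    exact (hΨ _ _).2 (Function.iterate_succ_apply' Ψ i _)

theorem existsUnique_isRun (hs : IsContractiveStep (Qx e) (QT e) L h) (hf : LipschitzWith L f)
    (k : ℕ) (S : Starter M d) (x₀ v₀ : Vec d) : ∃! u, IsRun e f k S h x₀ v₀ u := by
  choose Ψ hΨ using fun (n : ℕ) (z : Vec d × Vec d) =>
    exists_stepMap hs hf k (S h n z.1 z.2).1 (S h n z.1 z.2).2 z.1 z.2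
  refine ⟨fun n => Nat.rec (x₀, v₀) Ψ n, ⟨rfl, fun n => (hΨ n _ _).2 rfl⟩, fun u hu => ?_⟩
  funext n
  induction n with
  | zero => exact hu.1
  | succ n ih => rw [(hΨ n _ _).1 (hu.2 n), ih]

/-- The coefficients of the forces in the position and in the velocity at the end of a step. -/
noncomputable def endMatrix (e : Fin M → ℝ) : Matrix (Fin 2) (Fin (M + 1)) ℝ :=
  .of ![Matrix.vecMul (q e) (Q e), q e]

theorem norm_stepEnd_sub_le (h0 : 0 < h) (h1 : h ≤ 1) (x₀ v₀ : Vec d)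
    (W W' : Fin (M + 1) → Vec d) :
    ‖stepEnd e h x₀ v₀ W - stepEnd e h x₀ v₀ W'‖ ≤ h * (absSum (endMatrix e) * ‖W - W'‖) := by
  have hsq : h ^ 2 ≤ h := pow_le_of_le_one h0.le h1 two_ne_zero
  have hrow (i : Fin 2) : ‖∑ m, endMatrix e i m • (W m - W' m)‖ ≤
      absSum (endMatrix e) * ‖W - W'‖ :=
    norm_sum_smul_le_absSum (endMatrix e) (norm_nonneg _) (norm_le_pi_norm (W - W')) i
  refine max_le ?_ ?_
  · have hfst : (stepEnd e h x₀ v₀ W - stepEnd e h x₀ v₀ W').1 =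
        h ^ 2 • ∑ m, endMatrix e 0 m • (W m - W' m) := by
      simp [stepEnd, endMatrix, smul_sub, Finset.sum_sub_distrib]
    rw [hfst, norm_smul, Real.norm_of_nonneg (by positivity)]
    exact mul_le_mul hsq (hrow 0) (norm_nonneg _) h0.le
  · have hsnd : (stepEnd e h x₀ v₀ W - stepEnd e h x₀ v₀ W').2 =
        h • ∑ m, endMatrix e 1 m • (W m - W' m) := by
      simp [stepEnd, endMatrix, smul_sub, Finset.sum_sub_distrib]
    rw [hsnd, norm_smul, Real.norm_of_nonneg h0.le]
    exact mul_le_mul_of_nonneg_left (hrow 1) h0.le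

end Steps

section Sweeps

variable {M d : ℕ} {e : Fin M → ℝ} {f : Vec d × Vec d → Vec d} {L : NNReal} {h : ℝ}
  {k₀ : ℕ} {S : Starter M d}

/-- Each SDC iteration decreases the distance of the forces to those of collocation by a factor
`O(h ^ j)`. -/
def SweepOrder (e : Fin M → ℝ) (f : Vec d × Vec d → Vec d) (j : ℕ) : Prop :=
  ∃ c, 0 ≤ c ∧ ∀ᶠ h in 𝓝[>] 0, ∀ x₀ v₀ X V X' V' X'' V'',
    IsCollocationSolution e f h x₀ v₀ X V → IsSweep e f h x₀ v₀ X' V' X'' V'' →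
    ‖force f X V - force f X'' V''‖ ≤ c * h ^ j * ‖force f X V - force f X' V'‖

/-- The forces computed by `k` SDC iterations agree with those of collocation up to `O(h ^ s)`,
locally uniformly in the values at the beginning of the step. -/
def ForceOrder (e : Fin M → ℝ) (f : Vec d × Vec d → Vec d) (k : ℕ) (S : Starter M d) (s : ℕ) :
    Prop :=
  ∀ R : ℝ, ∃ C, ∀ᶠ h : ℝ in 𝓝[>] 0, ∀ (n : ℕ) (x₀ v₀ : Vec d), ‖x₀‖ ≤ R → ‖v₀‖ ≤ R → ∀ X V X' V',
    IsCollocationSolution e f h x₀ v₀ X V → X' 0 = (S h n x₀ v₀).1 → V' 0 = (S h n x₀ v₀).2 →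
      IsIteration e f k h x₀ v₀ X' V' → ‖force f X V - force f (X' k) (V' k)‖ ≤ C * h ^ s

theorem norm_sub_smul_act_sub_le {n : ℕ} {c : ℝ} (hc : 0 ≤ c) (A : Matrix (Fin n) (Fin n) ℝ)
    (a W W' : Fin n → Vec d) :
    ‖(a + c • act A W) - (a + c • act A W')‖ ≤ c * (absSum A * ‖W - W'‖) := by
  simpa using norm_add_smul_act_sub_le hc a a W W'

theorem sweepOrder_one (e : Fin M → ℝ) (hf : LipschitzWith L f) : SweepOrder e f 1 := by
  have hA := absSum_nonneg (Q e * Q e - Qx e)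
  have hB := absSum_nonneg (Q e - QT e)
  refine ⟨2 * L * (absSum (Q e * Q e - Qx e) + absSum (Q e - QT e)), by positivity, ?_⟩
  filter_upwards [eventually_isContractiveStep (Qx e) (QT e) L]
    with h hs x₀ v₀ X V X' V' X'' V'' hX hsweep
  have hsq : h ^ 2 ≤ h := pow_le_of_le_one hs.pos.le hs.le_one two_ne_zero
  have h0 := hs.pos
  set δ := ‖force f X V - force f X' V'‖
  refine ((isSweep_iff.1 hX.isSweep).norm_force_sub_le hs hf (isSweep_iff.1 hsweep)).trans ?_
  calc _ ≤ 2 * L * (h * ((absSum (Q e * Q e - Qx e) + absSum (Q e - QT e)) * δ)) := by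
        gcongr
        refine max_le ((norm_sub_smul_act_sub_le (sq_nonneg h) _ _ _ _).trans ?_)
          ((norm_sub_smul_act_sub_le h0.le _ _ _ _).trans ?_) <;> gcongr
        exacts [le_add_of_nonneg_right hB, le_add_of_nonneg_left hA]
    _ = _ := by ring

theorem sweepOrder_two_of_indep (e : Fin M → ℝ) (hf : LipschitzWith L f)
    (hind : ∀ y w w', f (y, w) = f (y, w')) : SweepOrder e f 2 := by
  have hA := absSum_nonneg (Q e * Q e - Qx e)
  refine ⟨2 * L * absSum (Q e * Q e - Qx e), by positivity, ?_⟩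
  filter_upwards [eventually_isContractiveStep (Qx e) (QT e) L]
    with h hs x₀ v₀ X V X' V' X'' V'' hX hsweep
  set δ := ‖force f X V - force f X' V'‖
  refine ((isSweep_iff.1 hX.isSweep).norm_force_sub_le_of_indep hs hf hind
    (isSweep_iff.1 hsweep)).trans ?_
  calc _ ≤ 2 * L * (h ^ 2 * (absSum (Q e * Q e - Qx e) * δ)) := by
        gcongr
        exact norm_sub_smul_act_sub_le (sq_nonneg h) _ _ _ _
    _ = _ := by ring

theorem le_pow_mul_of_le_mul {δ : ℕ → ℝ} {c : ℝ} {k : ℕ} (hc : 0 ≤ c)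
    (hδ : ∀ i < k, δ (i + 1) ≤ c * δ i) : δ k ≤ c ^ k * δ 0 := by
  induction k with
  | zero => simp
  | succ k ih =>
    calc δ (k + 1) ≤ c * δ k := hδ k k.lt_succ_self
      _ ≤ c * (c ^ k * δ 0) :=
        mul_le_mul_of_nonneg_left (ih fun i hi => hδ i (hi.trans k.lt_succ_self)) hc
      _ = c ^ (k + 1) * δ 0 := by ring

theorem StarterOrder.forceOrder_zero (hS : StarterOrder e f S k₀) (hf : LipschitzWith L f) :
    ForceOrder e f 0 S k₀ := by
  intro R
  obtain ⟨C₀, hC₀⟩ := hS R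
  refine ⟨L * |C₀|, ?_⟩
  filter_upwards [self_mem_nhdsWithin, eventually_nhdsGT_zero_iff.2 hC₀]
    with h (h0 : 0 < h) hstart n x₀ v₀ hx₀ hv₀ X V X' V' hX hX' hV' _
  have hle : C₀ * h ^ k₀ ≤ |C₀| * h ^ k₀ :=
    mul_le_mul_of_nonneg_right (le_abs_self C₀) (by positivity)
  have hpos : 0 ≤ |C₀| * h ^ k₀ := by positivity
  have hposition : ‖X - X' 0‖ ≤ |C₀| * h ^ k₀ := (pi_norm_le_iff_of_nonneg hpos).2 fun m => by
    rw [hX']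
    exact (hstart n x₀ v₀ hx₀ hv₀ X V hX m).1.trans hle
  have hvelocity : ‖V - V' 0‖ ≤ |C₀| * h ^ k₀ := (pi_norm_le_iff_of_nonneg hpos).2 fun m => by
    rw [hV']
    exact (hstart n x₀ v₀ hx₀ hv₀ X V hX m).2.trans hle
  calc ‖force f X V - force f (X' 0) (V' 0)‖ ≤ L * max ‖X - X' 0‖ ‖V - V' 0‖ :=
        norm_force_sub_le hf
    _ ≤ L * (|C₀| * h ^ k₀) := mul_le_mul_of_nonneg_left (max_le hposition hvelocity) L.2
    _ = L * |C₀| * h ^ k₀ := by ring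

theorem SweepOrder.forceOrder {j : ℕ} (hsweep : SweepOrder e f j) (hS : StarterOrder e f S k₀)
    (hf : LipschitzWith L f) (k : ℕ) : ForceOrder e f k S (j * k + k₀) := by
  intro R
  obtain ⟨c, hc0, hc⟩ := hsweep
  obtain ⟨C, hC⟩ := hS.forceOrder_zero hf R
  refine ⟨c ^ k * C, ?_⟩
  filter_upwards [self_mem_nhdsWithin, hc, hC]
    with h (h0 : 0 < h) hc hC n x₀ v₀ hx₀ hv₀ X V X' V' hX hX' hV' hit
  calc ‖force f X V - force f (X' k) (V' k)‖
      ≤ (c * h ^ j) ^ k * ‖force f X V - force f (X' 0) (V' 0)‖ :=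
        le_pow_mul_of_le_mul (δ := fun i => ‖force f X V - force f (X' i) (V' i)‖) (by positivity)
          fun i hi => hc x₀ v₀ X V _ _ _ _ hX (hit i hi)
    _ ≤ (c * h ^ j) ^ k * (C * h ^ k₀) := by
        gcongr
        exact hC n x₀ v₀ hx₀ hv₀ X V X' V' hX hX' hV' fun i hi => absurd hi i.not_lt_zero
    _ = c ^ k * C * h ^ (j * k + k₀) := by ring

theorem ForceOrder.exists_norm_stepEnd_sub_le {k s : ℕ} (hF : ForceOrder e f k S s) (R : ℝ) :
    ∃ C, ∀ᶠ h : ℝ in 𝓝[>] 0, ∀ (n : ℕ) (y z : Vec d × Vec d) X V, ‖y‖ ≤ R →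
      IsCollocationSolution e f h y.1 y.2 X V →
      IsStep e f k h (S h n y.1 y.2).1 (S h n y.1 y.2).2 y.1 y.2 z.1 z.2 →
      ‖stepEnd e h y.1 y.2 (force f X V) - z‖ ≤ C * h ^ (s + 1) := by
  obtain ⟨C, hC⟩ := hF R
  refine ⟨absSum (endMatrix e) * C, ?_⟩
  filter_upwards [eventually_pos_and_le_one, hC] with h ⟨h0, h1⟩ hC n y z X V hy hX hstep
  obtain ⟨X', V', hX', hV', hit, rfl⟩ := isStep_iff.1 hstep
  calc _ ≤ h * (absSum (endMatrix e) * ‖force f X V - force f (X' k) (V' k)‖) :=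
        norm_stepEnd_sub_le h0 h1 _ _ _ _
    _ ≤ h * (absSum (endMatrix e) * (C * h ^ s)) := by
        have hE := absSum_nonneg (endMatrix e)
        gcongr
        exact hC n y.1 y.2 ((norm_fst_le y).trans hy) ((norm_snd_le y).trans hy) X V X' V' hX
          hX' hV' hit
    _ = absSum (endMatrix e) * C * h ^ (s + 1) := by ring

end Sweeps

section FirstOrderSystem

variable {M d : ℕ} {e : Fin M → ℝ} {f : Vec d × Vec d → Vec d} {L : NNReal} {h : ℝ}
  {x₀ v₀ : Vec d} {X V : Fin (M + 1) → Vec d}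

/-- The right-hand side of the first-order system for `(x, v)`. -/
def vectorField (f : Vec d × Vec d → Vec d) (y : Vec d × Vec d) : Vec d × Vec d := (y.2, f y)

theorem lipschitzWith_vectorField (hf : LipschitzWith L f) :
    LipschitzWith (max 1 L) (vectorField f) :=
  LipschitzWith.prodMk LipschitzWith.prod_snd hf

theorem act_Q_succ (W : Fin (M + 1) → Vec d) (j : Fin M) :
    act (Q e) W j.succ = ∑ k, weight e (e j) k • W k.succ := by
  simp [act, Q, Fin.sum_univ_succ]

theorem sum_q_smul (W : Fin (M + 1) → Vec d) :
    ∑ m, q e m • W m = ∑ k, weight e 1 k • W k.succ := by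
  simp [q, Fin.sum_univ_succ]

theorem IsCollocationSolution.position_eq (hX : IsCollocationSolution e f h x₀ v₀ X V) :
    X = (fun _ => x₀) + h • act (Q e) V := by
  have hQV : act (Q e) V = act (Q e) (fun _ => v₀) + h • act (Q e * Q e) (force f X V) := by
    nth_rewrite 1 [hX.2]
    rw [act_add, act_smul, act_mul]
  rw [hQV, smul_add, smul_smul, ← sq, ← add_assoc]
  exact hX.1

theorem IsCollocationSolution.isCollocationStages (hX : IsCollocationSolution e f h x₀ v₀ X V) :
    IsCollocationStages e (vectorField f) h (x₀, v₀) fun j => (X j.succ, V j.succ) := by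
  intro j
  have hposition := congrFun hX.position_eq j.succ
  have hvelocity := congrFun hX.2 j.succ
  simp only [Pi.add_apply, Pi.smul_apply, act_Q_succ] at hposition hvelocity
  refine Prod.ext ?_ ?_
  · simpa only [Prod.fst_add, Prod.smul_fst, Prod.fst_sum, vectorField] using hposition
  · simpa only [Prod.snd_add, Prod.smul_snd, Prod.snd_sum, vectorField, force] using hvelocity

theorem IsCollocationSolution.stepEnd_eq (hX : IsCollocationSolution e f h x₀ v₀ X V) :
    stepEnd e h x₀ v₀ (force f X V) =
      collocationEnd e (vectorField f) h (x₀, v₀) fun j => (X j.succ, V j.succ) := by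
  have hqV : ∑ m, q e m • V m =
      ∑ m, q e m • v₀ + h • ∑ m, (Matrix.vecMul (q e) (Q e)) m • force f X V m := by
    nth_rewrite 1 [hX.2]
    simp only [sum_vecMul_smul, Pi.add_apply, Pi.smul_apply, smul_add, Finset.sum_add_distrib,
      Finset.smul_sum, smul_comm h]
  refine Prod.ext ?_ ?_
  · simp only [stepEnd, collocationEnd, vectorField, Prod.fst_add, Prod.smul_fst, Prod.fst_sum]
    rw [← sum_q_smul V, hqV, smul_add, smul_smul, ← sq, add_assoc]
  · simp only [stepEnd, collocationEnd, vectorField, Prod.snd_add, Prod.smul_snd, Prod.snd_sum,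
      sum_q_smul, force]

end FirstOrderSystem

/-! ### Global convergence -/

section Global

-- The recursion is only available while the error is at most `1`, which the smallness of `δ`
-- guarantees at every step.
theorem le_of_recursion_of_le_one {E : ℕ → ℝ} {C δ h τ : ℝ} (hC : 0 ≤ C) (hδ : 0 ≤ δ) (h0 : 0 < h)
    (hsmall : τ * Real.exp (C * τ) * δ ≤ 1) (hE0 : E 0 = 0)
    (hE : ∀ n : ℕ, (n + 1 : ℝ) * h ≤ τ → E n ≤ 1 → E (n + 1) ≤ (1 + C * h) * E n + h * δ) {n : ℕ}
    (hn : n * h ≤ τ) : E n ≤ τ * Real.exp (C * τ) * δ := by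
  have hgrowth {n : ℕ} (hn : n * h ≤ τ) :
      n * h * Real.exp (C * (n * h)) * δ ≤ τ * Real.exp (C * τ) * δ := by
    have hτ : 0 ≤ τ := le_trans (by positivity) hn
    gcongr
  refine le_trans ?_ (hgrowth hn)
  induction n with
  | zero => simp [hE0]
  | succ n ih =>
    push_cast at hn ⊢
    have hn' : n * h ≤ τ := by linarith
    have hfactor : (1 + C * h) * Real.exp (C * (n * h)) ≤ Real.exp (C * ((n + 1) * h)) := by
      rw [show C * ((n + 1) * h) = C * h + C * (n * h) by ring, Real.exp_add, add_comm 1]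
      gcongr
      exact Real.add_one_le_exp _
    have hone : 1 ≤ Real.exp (C * ((n + 1) * h)) := Real.one_le_exp (by positivity)
    calc E (n + 1) ≤ (1 + C * h) * E n + h * δ :=
          hE n hn ((ih hn').trans ((hgrowth hn').trans hsmall))
      _ ≤ (1 + C * h) * (n * h * Real.exp (C * (n * h)) * δ) + h * δ := by
          gcongr
          exact ih hn'
      _ = n * h * ((1 + C * h) * Real.exp (C * (n * h))) * δ + h * 1 * δ := by ring
      _ ≤ n * h * Real.exp (C * ((n + 1) * h)) * δ + h * Real.exp (C * ((n + 1) * h)) * δ := by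
          gcongr
      _ = (n + 1) * h * Real.exp (C * ((n + 1) * h)) * δ := by ring

variable {M d p k s : ℕ} {e : Fin M → ℝ} {f : Vec d × Vec d → Vec d} {L : NNReal} {t₀ T : ℝ}
  {x v : ℝ → Vec d} {S : Starter M d}

theorem IsSolution.hasDerivWithinAt_prodMk (hsol : IsSolution f t₀ T x v) (t : ℝ)
    (ht : t ∈ Icc t₀ T) :
    HasDerivWithinAt (fun t => (x t, v t)) (vectorField f (x t, v t)) (Icc t₀ T) t :=
  (hsol t ht).1.prodMk (hsol t ht).2

theorem IsSolution.exists_local_error (hsol : IsSolution f t₀ T x v)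
    (he : Function.Injective e) (he01 : ∀ j, e j ∈ Icc (0 : ℝ) 1) (hquad : QuadratureOrder e p)
    (hf : LipschitzWith L f) (hT : t₀ < T)
    (hreg : ContDiffOn ℝ p (fun t => f (x t, v t)) (Icc t₀ T))
    (hsmooth : M + 1 < p → ∃ U : Set (Vec d × Vec d), IsOpen U ∧
      (∀ t ∈ Icc t₀ T, (x t, v t) ∈ U) ∧ ContDiffOn ℝ p f U) :
    ∃ C, ∀ᶠ h : ℝ in 𝓝[>] 0, ∀ t, t₀ ≤ t → t + h ≤ T → ∀ X V,
      IsCollocationSolution e f h (x t) (v t) X V →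
      ‖stepEnd e h (x t) (v t) (force f X V) - (x (t + h), v (t + h))‖ ≤ C * h ^ (p + 1) := by
  have hv : ContDiffOn ℝ p v (Icc t₀ T) :=
    (contDiffOn_succ_of_hasDerivWithinAt hT (fun t ht => (hsol t ht).2) hreg).of_le
      (by norm_cast; exact p.le_succ)
  obtain ⟨C, hC⟩ := collocation_local_error he he01 hquad (lipschitzWith_vectorField hf) hT
    hsol.hasDerivWithinAt_prodMk (hv.prodMk hreg) fun hM => by
      obtain ⟨U, hU, hxU, hfU⟩ := hsmooth hM
      exact ⟨U, hU, hxU, contDiff_snd.contDiffOn.prodMk hfU⟩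
  refine ⟨C, hC.mono fun h hC t ht₀ htT X V hX => ?_⟩
  rw [hX.stepEnd_eq]
  exact hC t ht₀ htT _ hX.isCollocationStages

theorem exists_lipschitz_collocation_stepEnd (e : Fin M → ℝ) (hf : LipschitzWith L f) :
    ∃ C, 0 ≤ C ∧ ∀ᶠ h : ℝ in 𝓝[>] 0, ∀ (y z : Vec d × Vec d) X V X' V',
      IsCollocationSolution e f h y.1 y.2 X V → IsCollocationSolution e f h z.1 z.2 X' V' →
      ‖stepEnd e h y.1 y.2 (force f X V) - stepEnd e h z.1 z.2 (force f X' V')‖ ≤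
        (1 + C * h) * ‖y - z‖ := by
  obtain ⟨C, hC0, hC⟩ := exists_lipschitz_collocationEnd e (lipschitzWith_vectorField hf)
  refine ⟨C, hC0, hC.mono fun h hC y z X V X' V' hX hX' => ?_⟩
  rw [hX.stepEnd_eq, hX'.stepEnd_eq]
  exact hC y z _ _ hX.isCollocationStages hX'.isCollocationStages

-- Lady Windermere's fan: the new error consists of the local error of collocation, the propagated
-- old error and the error of the iteration.
theorem IsSolution.exists_error_recursion (hsol : IsSolution f t₀ T x v)
    (he : Function.Injective e) (he01 : ∀ j, e j ∈ Icc (0 : ℝ) 1) (hquad : QuadratureOrder e p)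
    (hf : LipschitzWith L f) (hT : t₀ < T)
    (hreg : ContDiffOn ℝ p (fun t => f (x t, v t)) (Icc t₀ T))
    (hsmooth : M + 1 < p → ∃ U : Set (Vec d × Vec d), IsOpen U ∧
      (∀ t ∈ Icc t₀ T, (x t, v t) ∈ U) ∧ ContDiffOn ℝ p f U) (hF : ForceOrder e f k S s) :
    ∃ C D, 0 ≤ C ∧ 0 ≤ D ∧ ∀ᶠ h : ℝ in 𝓝[>] 0, ∀ t, t₀ ≤ t → t + h ≤ T →
      ∀ (n : ℕ) (y z : Vec d × Vec d), ‖(x t, v t) - y‖ ≤ 1 →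
      IsStep e f k h (S h n y.1 y.2).1 (S h n y.1 y.2).2 y.1 y.2 z.1 z.2 →
      ‖(x (t + h), v (t + h)) - z‖ ≤
        (1 + C * h) * ‖(x t, v t) - y‖ + D * h ^ (min p s + 1) := by
  obtain ⟨R, hR⟩ := isCompact_Icc.exists_bound_of_continuousOn
    fun t ht => (hsol.hasDerivWithinAt_prodMk t ht).continuousWithinAt
  obtain ⟨C₁, hlocal⟩ := hsol.exists_local_error he he01 hquad hf hT hreg hsmooth
  obtain ⟨C, hC0, hstable⟩ := exists_lipschitz_collocation_stepEnd e hf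
  obtain ⟨C₂, hiteration⟩ := hF.exists_norm_stepEnd_sub_le (R + 1)
  refine ⟨C, |C₁| + |C₂|, hC0, by positivity, ?_⟩
  filter_upwards [eventually_pos_and_le_one, hlocal, hstable, hiteration,
    eventually_isContractiveStep (Q e * Q e) (Q e) L]
    with h ⟨h0, h1⟩ hlocal hstable hiteration hs t ht₀ htT n y z hy hstep
  obtain ⟨X, V, hX⟩ := exists_isCollocationSolution hs hf (x t) (v t)
  obtain ⟨X', V', hX'⟩ := exists_isCollocationSolution hs hf y.1 y.2
  have hyR : ‖y‖ ≤ R + 1 := (norm_le_norm_add_norm_sub (x t, v t) y).trans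
    (add_le_add (hR t ⟨ht₀, by linarith⟩) hy)
  have hpow {C : ℝ} {r : ℕ} (hr : min p s ≤ r) :
      C * h ^ (r + 1) ≤ |C| * h ^ (min p s + 1) :=
    mul_le_mul (le_abs_self C) (pow_le_pow_of_le_one h0.le h1 (Nat.succ_le_succ hr))
      (by positivity) (abs_nonneg C)
  set Φ := stepEnd e h (x t) (v t) (force f X V)
  set Ψ := stepEnd e h y.1 y.2 (force f X' V')
  calc ‖(x (t + h), v (t + h)) - z‖
      = ‖((x (t + h), v (t + h)) - Φ) + (Φ - Ψ) + (Ψ - z)‖ := by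
        rw [sub_add_sub_cancel, sub_add_sub_cancel]
    _ ≤ |C₁| * h ^ (min p s + 1) + (1 + C * h) * ‖(x t, v t) - y‖ +
        |C₂| * h ^ (min p s + 1) := norm_add_le_of_le (norm_add_le_of_le
          (by rw [norm_sub_rev]; exact (hlocal t ht₀ htT X V hX).trans (hpow (min_le_left p s)))
          (hstable (x t, v t) y X V X' V' hX hX'))
          ((hiteration n y z X' V' hyR hX' hstep).trans (hpow (min_le_right p s)))
    _ = (1 + C * h) * ‖(x t, v t) - y‖ + (|C₁| + |C₂|) * h ^ (min p s + 1) := by ring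

theorem IsSolution.convergesWithOrder (hsol : IsSolution f t₀ T x v)
    (he : Function.Injective e) (he01 : ∀ j, e j ∈ Icc (0 : ℝ) 1) (hp : 0 < p)
    (hquad : QuadratureOrder e p) (hf : LipschitzWith L f) (hT : t₀ < T)
    (hreg : ContDiffOn ℝ p (fun t => f (x t, v t)) (Icc t₀ T))
    (hsmooth : M + 1 < p → ∃ U : Set (Vec d × Vec d), IsOpen U ∧
      (∀ t ∈ Icc t₀ T, (x t, v t) ∈ U) ∧ ContDiffOn ℝ p f U) (hs : 0 < s)
    (hF : ForceOrder e f k S s) : ConvergesWithOrder e f k S t₀ T x v (min p s) := by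
  obtain ⟨C, D, hC, hD, hrec⟩ := hsol.exists_error_recursion he he01 hquad hf hT hreg hsmooth hF
  set r := min p s
  have hr : r ≠ 0 := (lt_min hp hs).ne'
  set B := (T - t₀) * Real.exp (C * (T - t₀)) * D
  refine ⟨B, eventually_nhdsGT_zero_iff.1 ?_⟩
  filter_upwards [eventually_pos_and_le_one, eventually_mul_le_half B,
    eventually_isContractiveStep (Qx e) (QT e) L, hrec] with h ⟨h0, h1⟩ hB hsweep hrec
  refine ⟨existsUnique_isRun hsweep hf k S _ _, fun u hu n hn => ?_⟩
  have hB0 : 0 ≤ B := mul_nonneg (mul_nonneg (sub_nonneg.2 hT.le) (Real.exp_pos _).le) hD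
  have hsmall : B * h ^ r ≤ 1 := by
    have hpow : B * h ^ r ≤ B * h := mul_le_mul_of_nonneg_left (pow_le_of_le_one h0.le h1 hr) hB0
    linarith
  have herror : ‖(x (t₀ + n * h), v (t₀ + n * h)) - u n‖ ≤ B * h ^ r := by
    rw [mul_assoc _ D] at hsmall ⊢
    refine le_of_recursion_of_le_one
      (E := fun n => ‖(x (t₀ + n * h), v (t₀ + n * h)) - u n‖) hC (by positivity) h0 hsmall
      (by simp [hu.1]) (fun n hn hle => ?_) (by linarith)
    have hnh : 0 ≤ n * h := by positivity
    have hstep := hrec (t₀ + n * h) (by linarith) (by linarith) n (u n) (u (n + 1)) hle (hu.2 n)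
    rw [show t₀ + n * h + h = t₀ + (n + 1 : ℕ) * h by push_cast; ring] at hstep
    refine hstep.trans_eq ?_
    ring
  exact ⟨(norm_fst_le _).trans herror, (norm_snd_le _).trans herror⟩

end Global

end SDC

theorem theorem4p2_general {M d : ℕ} (e : Fin M → ℝ) (he : Function.Injective e)
    (he01 : ∀ j, e j ∈ Set.Icc (0 : ℝ) 1)
    (p : ℕ) (hp : 0 < p) (hquad : SDC.QuadratureOrder e p)
    (f : SDC.Vec d × SDC.Vec d → SDC.Vec d) (L : NNReal) (hf : LipschitzWith L f)
    (t₀ T : ℝ) (hT : t₀ < T) (x v : ℝ → SDC.Vec d) (hsol : SDC.IsSolution f t₀ T x v)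
    (hreg : ContDiffOn ℝ p (fun t => f (x t, v t)) (Set.Icc t₀ T))
    (hsmooth : M + 1 < p → ∃ U : Set (SDC.Vec d × SDC.Vec d), IsOpen U ∧
      (∀ t ∈ Set.Icc t₀ T, (x t, v t) ∈ U) ∧ ContDiffOn ℝ p f U)
    (S : SDC.Starter M d) (k k₀ : ℕ) (hk : 0 < k + k₀) (hS : SDC.StarterOrder e f S k₀) :
    SDC.ConvergesWithOrder e f k S t₀ T x v (min p (k + k₀)) ∧
    ((∀ y w w', f (y, w) = f (y, w')) →
      SDC.ConvergesWithOrder e f k S t₀ T x v (min p (2 * k + k₀))) := by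
  refine ⟨hsol.convergesWithOrder he he01 hp hquad hf hT hreg hsmooth hk ?_, fun hind =>
    hsol.convergesWithOrder he he01 hp hquad hf hT hreg hsmooth (by lia)
      ((SDC.sweepOrder_two_of_indep e hf hind).forceOrder hS hf k)⟩
  simpa only [one_mul] using (SDC.sweepOrder_one e hf).forceOrder hS hf k

theorem theorem4p2 {M d : ℕ} (e : Fin M → ℝ) (he : StrictMono e)
    (he01 : ∀ j, e j ∈ Set.Icc (0 : ℝ) 1)
    (p : ℕ) (hp : 0 < p) (hquad : SDC.QuadratureOrder e p)
    (f : SDC.Vec d × SDC.Vec d → SDC.Vec d) (L : NNReal) (hf : LipschitzWith L f)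
    (t₀ T : ℝ) (hT : t₀ < T) (x v : ℝ → SDC.Vec d) (hsol : SDC.IsSolution f t₀ T x v)
    (hreg : ContDiffOn ℝ p (fun t => f (x t, v t)) (Set.Icc t₀ T))
    (hsmooth : M + 1 < p → ∃ U : Set (SDC.Vec d × SDC.Vec d), IsOpen U ∧
      (∀ t ∈ Set.Icc t₀ T, (x t, v t) ∈ U) ∧ ContDiffOn ℝ p f U)
    (S : SDC.Starter M d) (k k₀ : ℕ) (hk : 0 < k + k₀) (hS : SDC.StarterOrder e f S k₀) :
    SDC.ConvergesWithOrder e f k S t₀ T x v (min p (k + k₀)) ∧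
    ((∀ y w w', f (y, w) = f (y, w')) →
      SDC.ConvergesWithOrder e f k S t₀ T x v (min p (2 * k + k₀))) :=
  theorem4p2_general e he.injective he01 p hp hquad f L hf t₀ T hT x v hsol hreg hsmooth S k k₀
    hk hS
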